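/- Let $\Gamma$ be a Boolean constraint language, i.e. a (fixed, possibly infinite) set of relations $R\subseteq\{0,1\}^k$ of various arities $k$, and suppose that every $R\in\Gamma$ is closed under the Boolean minority operation, the unique $g:\{0,1\}^3\to\{0,1\}$ with $g(a,a,b)=g(a,b,a)=g(b,a,a)=b$ for all $a,b$ (that is, applying $g$ coordinatewise to any three tuples of $R$ gives a tuple of $R$). Let $d\ge 0$ be a constant and let $\mathbb F$ be a field of characteristic $0$ (for instance $\mathbb R$). Consider the problem $\mathrm{IMP}_d(\Gamma)$. Its input consists of an instance $\mathcal C$ of $\mathrm{CSP}(\Gamma)$, i.e. variables $x_1,\dots,x_n$ and finitely many constraints $R(x_{i_1},\dots,x_{i_k})$ with $R\in\Gamma$, each relation being given by a list of its tuples, and of a polynomial $f\in\mathbb Q[x_1,\dots,x_n]$ of degree at most $d$, given as a list of terms of degree at most $d$ with coefficients written in binary. The question is whether $f$ belongs to the combinatorial ideal of $\mathcal C$, i.e. the ideal of all polynomials in $\mathbb F[x_1,\dots,x_n]$ that vanish at every point of the set $\mathrm{Sol}(\mathcal C)\subseteq\{0,1\}^n\subseteq\mathbb F^n$ of assignments that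 satisfy all the constraints. Then $\mathrm{IMP}_d(\Gamma)$ can be solved in polynomial time: there is a deterministic Turing machine (depending on $\Gamma$, $d$ and $\mathbb F$) that answers this question on every input in a number of steps bounded by a polynomial in the length of the input. -/

import Mathlib

namespace BooleanIMP

/-- A `k`-ary relation on `D`: a set of `k`-tuples. -/
abbrev Relation (D : Type) (k : ℕ) : Type := Set (Fin k → D)

/-- A constraint language over `D`: an arbitrary (finite or infinite) set of relations over `D`,
each with its arity. -/
abbrev ConstraintLanguage (D : Type) : Type := Set (Σ k : ℕ, Relation D k)

/-- The operation `g : D^m → D` is a polymorphism of the relation `R` (that is, `R` is closed under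
`g`): applying `g` coordinatewise to any `m` tuples of `R` (repetitions allowed) gives a tuple
of `R`. -/
def IsPolymorphism {D : Type} {m k : ℕ} (g : (Fin m → D) → D) (R : Relation D k) : Prop :=
  ∀ t : Fin m → (Fin k → D), (∀ j, t j ∈ R) → (fun i => g (fun j => t j i)) ∈ R

/-- A ternary operation `g` is a minority operation:
`g (a, a, b) = g (a, b, a) = g (b, a, a) = b`. On a two-element domain there is exactly one. -/
def IsMinority {D : Type} (g : (Fin 3 → D) → D) : Prop :=
  ∀ a b : D, g ![a, a, b] = b ∧ g ![a, b, a] = b ∧ g ![b, a, a] = b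

/-- A constraint `R(x_{i_1}, …, x_{i_k})` over the language `Γ` with variables in `X` (not
necessarily distinct). The relation `R ∈ Γ` is given by a list of its tuples, in any order. -/
structure Constraint {D : Type} (Γ : ConstraintLanguage D) (X : Type) where
  arity : ℕ
  scope : Fin arity → X
  tuples : List (Fin arity → D)
  mem_language : (⟨arity, {t | t ∈ tuples}⟩ : Σ k : ℕ, Relation D k) ∈ Γ

/-- The relation of a constraint. -/
def Constraint.relation {D : Type} {Γ : ConstraintLanguage D} {X : Type} (C : Constraint Γ X) :
    Relation D C.arity :=
  {t | t ∈ C.tuples}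

/-- An instance of `CSP(Γ)`: the variables `x_0, …, x_{n-1}` and finitely many constraints over `Γ`
on these variables. -/
structure CSPInstance {D : Type} (Γ : ConstraintLanguage D) where
  numVars : ℕ
  constraints : List (Constraint Γ (Fin numVars))

/-- The set of solutions: the assignments that satisfy all the constraints. -/
def CSPInstance.Sol {D : Type} {Γ : ConstraintLanguage D} (I : CSPInstance Γ) :
    Set (Fin I.numVars → D) :=
  {φ | ∀ C ∈ I.constraints, (fun i => φ (C.scope i)) ∈ C.relation}

/-- The Boolean domain `{0, 1}` as a subset of a field. -/
def boolVal (F : Type*) [Field F] (b : Bool) : F := if b then 1 else 0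

/-- The combinatorial ideal of a Boolean instance over the field `F`: the vanishing ideal in
`F[x_0, …, x_{n-1}]` of the solution set, viewed as a set of points of `F^n`. -/
noncomputable def combinatorialIdeal (F : Type*) [Field F] {Γ : ConstraintLanguage Bool}
    (I : CSPInstance Γ) : Ideal (MvPolynomial (Fin I.numVars) F) :=
  MvPolynomial.vanishingIdeal F ((fun φ i => boolVal F (φ i)) '' I.Sol)

/-- An input of `IMP_d(Γ)`: an instance of `CSP(Γ)` and a polynomial of degree at most `d` with
rational coefficients, in sparse representation: a list of terms, where `(c, [i_1, …, i_r])` with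
`r ≤ d` stands for the term `c * x_{i_1} * ⋯ * x_{i_r}`. -/
structure IMPInstance (Γ : ConstraintLanguage Bool) (d : ℕ) where
  csp : CSPInstance Γ
  terms : List (ℚ × List (Fin csp.numVars))
  degree_le : ∀ t ∈ terms, t.2.length ≤ d

/-- The input polynomial. -/
noncomputable def IMPInstance.poly {Γ : ConstraintLanguage Bool} {d : ℕ} (I : IMPInstance Γ d) :
    MvPolynomial (Fin I.csp.numVars) ℚ :=
  (I.terms.map fun t => MvPolynomial.C t.1 * (t.2.map MvPolynomial.X).prod).sum

/-- The question of the ideal membership problem over a field `F` of characteristic zero: does the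
input polynomial belong to the combinatorial ideal in `F[x_0, …, x_{n-1}]`? -/
def IMPInstance.Member (F : Type*) [Field F] [CharZero F] {Γ : ConstraintLanguage Bool} {d : ℕ}
    (I : IMPInstance Γ d) : Prop :=
  MvPolynomial.map (algebraMap ℚ F) I.poly ∈ combinatorialIdeal F I.csp

/-- The finite alphabet in which inputs are written. -/
inductive Letter
  | tick
  | bit (b : Bool)
  | var
  | con
  | tup
  | term
  | slash
  | sep
  deriving DecidableEq, Fintype

/-- The variable `x_i` is written as a marker followed by `i` ticks. -/
def encodeVar {n : ℕ} (i : Fin n) : List Letter :=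
  Letter.var :: List.replicate i.val Letter.tick

/-- A constraint is written as its list of variables followed by the list of the tuples of its
relation. -/
def encodeConstraint {Γ : ConstraintLanguage Bool} {n : ℕ} (C : Constraint Γ (Fin n)) :
    List Letter :=
  Letter.con :: ((List.ofFn C.scope).flatMap encodeVar ++
    C.tuples.flatMap fun t => Letter.tup :: (List.ofFn t).map Letter.bit)

/-- A rational number is written as a sign bit, the numerator in binary, a slash, and the
denominator in binary. -/
def encodeRat (c : ℚ) : List Letter :=
  Letter.bit (decide (c.num < 0)) ::
    (c.num.natAbs.bits.map Letter.bit ++ Letter.slash :: c.den.bits.map Letter.bit)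

/-- A term is written as its coefficient followed by its variables. -/
def encodeTerm {n : ℕ} (t : ℚ × List (Fin n)) : List Letter :=
  Letter.term :: (encodeRat t.1 ++ t.2.flatMap encodeVar)

/-- The encoding of an input of `IMP_d(Γ)`: the `n` variables (one tick each), the constraints, and
the terms of the polynomial. -/
def encodeIMP {Γ : ConstraintLanguage Bool} {d : ℕ} (I : IMPInstance Γ d) : List Letter :=
  List.replicate I.csp.numVars Letter.tick ++
    Letter.sep :: (I.csp.constraints.flatMap encodeConstraint ++
      Letter.sep :: I.terms.flatMap encodeTerm)

open Classical in
/-- The decision problem `P` on inputs of type `α`, written as words over the alphabet `A` by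
`enc`, is solvable in polynomial time: some (deterministic, multi-stack) Turing machine outputs, on
the word `enc a` of any input `a`, the truth value of `P a` after a number of steps bounded by a
fixed polynomial in the length of this word. -/
def SolvableInPolyTime {α A : Type} (enc : α → List A) (P : α → Prop) : Prop :=
  Nonempty (Turing.TM2ComputableInPolyTime enc Computability.encodeBool fun a => decide (P a))

end BooleanIMP

/-! On {0,1} the minority operation is x + y + z over the field with two elements
(`minority_eq_xor`). A relation closed under it contains every sum of an odd number of its tuples
(`combination_mem`), so it is empty or an affine subspace, and `Sol` is the solution set of a linear
system over that field. The system can be written down directly: for each constraint take one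
unknown coefficient per listed tuple, require the coefficients to have odd sum and the variables to
be the corresponding combination, and eliminate the coefficients (`sat_constraintRows`).

Membership in the ideal means vanishing on `Sol`, and since ℚ embeds into `F` this concerns rational
values only (`member_iff`). A sum of rational squares is zero only if every square is, so f vanishes
on `Sol` iff the sum of f² over `Sol` is zero, and by linearity iff f is orthogonal on `Sol` to each
of its own monomials (`vanishes_iff_orthogonal`). The inner product of two monomials is the number
of solutions at which all variables of both equal one, that is, the number of solutions of the
system enlarged by equations x_i = 1 (`val_commonCount`). Gaussian elimination yields it as zero or
a power of two (`val_countSol`), written in binary, and only a sum of rational numbers remains.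

Polynomial time is proved for actual machines. Values are trees in prefix notation on a stack, and
`PTime` is closed under composition, pairing, case distinction and left folds with polynomially
bounded intermediate values (`PTime.foldl`). Parsing, elimination and summation are such folds:
elimination never enlarges the bounds on the number and the length of rows (`RowsBdd.elim`), and
each addition of fractions lengthens the numbers by a bounded amount only (`length_addFraction`).
Finally `PTime.solvable` turns the function into a Turing machine. -/

namespace PolyTime

open BooleanIMP

/-! ### Stack memories and structured flow charts -/

/-- The stacks of the machines: input, output, the main work stack and three auxiliary stacks. -/
inductive Stack
  | inp
  | out
  | main
  | flag
  | left
  | right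
  deriving DecidableEq

instance : Fintype Stack where
  elems := {.inp, .out, .main, .flag, .left, .right}
  complete x := by cases x <;> decide

/-- The alphabet of a stack. -/
abbrev Sym : Stack → Type
  | .inp => Letter
  | _ => Bool

instance : ∀ k, Fintype (Sym k)
  | .inp => inferInstanceAs (Fintype Letter)
  | .out | .main | .flag | .left | .right => inferInstanceAs (Fintype Bool)

/-- The contents of all stacks. -/
abbrev Mem : Type := ∀ k, List (Sym k)

/-- The memory with given stack contents. -/
def mem (i : List Letter) (o s f l r : List Bool) : Mem
  | .inp => i
  | .out => o
  | .main => s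
  | .flag => f
  | .left => l
  | .right => r

section
variable (i : List Letter) (o s f l r : List Bool)

@[simp] theorem mem_inp : mem i o s f l r .inp = i := rfl
@[simp] theorem mem_out : mem i o s f l r .out = o := rfl
@[simp] theorem mem_main : mem i o s f l r .main = s := rfl
@[simp] theorem mem_flag : mem i o s f l r .flag = f := rfl
@[simp] theorem mem_left : mem i o s f l r .left = l := rfl
@[simp] theorem mem_right : mem i o s f l r .right = r := rfl

@[simp] theorem update_inp (x : List Letter) :
    Function.update (mem i o s f l r) .inp x = mem x o s f l r := by
  funext k; cases k <;> rfl
@[simp] theorem update_out (x : List Bool) :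
    Function.update (mem i o s f l r) .out x = mem i x s f l r := by
  funext k; cases k <;> rfl
@[simp] theorem update_main (x : List Bool) :
    Function.update (mem i o s f l r) .main x = mem i o x f l r := by
  funext k; cases k <;> rfl
@[simp] theorem update_flag (x : List Bool) :
    Function.update (mem i o s f l r) .flag x = mem i o s x l r := by
  funext k; cases k <;> rfl
@[simp] theorem update_left (x : List Bool) :
    Function.update (mem i o s f l r) .left x = mem i o s f x r := by
  funext k; cases k <;> rfl
@[simp] theorem update_right (x : List Bool) :
    Function.update (mem i o s f l r) .right x = mem i o s f l x := by
  funext k; cases k <;> rfl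

end

/-- An elementary instruction with successor labels in `L`. -/
inductive Instr (L : Type)
  | push (k : Stack) (a : Sym k) (next : L)
  | pop (k : Stack) (next : Option (Sym k) → L)

namespace Instr

variable {L L' : Type}

/-- Renaming of labels. -/
def map (φ : L → L') : Instr L → Instr L'
  | push k a n => push k a (φ n)
  | pop k n => pop k fun o => φ (n o)

/-- The effect of an instruction. -/
def exec : Instr L → Mem → L × Mem
  | push k a n, m => (n, Function.update m k (a :: m k))
  | pop k n, m => (n (m k).head?, Function.update m k (m k).tail)

theorem exec_map (φ : L → L') (c : Instr L) (m : Mem) :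
    (c.map φ).exec m = (φ (c.exec m).1, (c.exec m).2) := by
  cases c <;> rfl

end Instr

/-- A program fragment: a finite flow chart with one entry and one exit, the latter being `none`. -/
structure Frag where
  Lbl : Type
  [fin : Fintype Lbl]
  entry : Option Lbl
  code : Lbl → Instr (Option Lbl)

attribute [instance] Frag.fin

/-- `Reach F n c c'`: the fragment `F` leads from `c` to `c'` in exactly `n` steps. -/
inductive Reach (F : Frag) : ℕ → Option F.Lbl × Mem → Option F.Lbl × Mem → Prop
  | refl (c) : Reach F 0 c c
  | step {l : F.Lbl} {m : Mem} {n c} :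
      Reach F n ((F.code l).exec m) c → Reach F (n + 1) (some l, m) c

theorem Reach.trans {F : Frag} {n n' c c' c''} (h : Reach F n c c') (h' : Reach F n' c' c'') :
    Reach F (n + n') c c'' := by
  induction h with
  | refl c => simpa using h'
  | step _ ih =>
    rw [Nat.add_right_comm]
    exact .step (ih h')

/-- A run of a fragment is also a run of any flow chart into which it is embedded. -/
theorem Reach.embed {F G : Frag} (φ : F.Lbl → G.Lbl) (e : Option G.Lbl)
    (h : ∀ l, G.code (φ l) = (F.code l).map fun o => o.elim e fun l => some (φ l))
    {n c c'} (hr : Reach F n c c') :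
    Reach G n (c.1.elim e fun l => some (φ l), c.2) (c'.1.elim e fun l => some (φ l), c'.2) := by
  induction hr with
  | refl c => exact .refl _
  | step _ ih =>
    refine .step ?_
    rw [h, Instr.exec_map]
    exact ih

/-- `Runs F m n m'`: started with memory `m`, the fragment `F` ends with memory `m'` after at
most `n` steps. -/
def Runs (F : Frag) (m : Mem) (n : ℕ) (m' : Mem) : Prop :=
  ∃ t ≤ n, Reach F t (F.entry, m) (none, m')

theorem Runs.mono {F : Frag} {m m' : Mem} {n n' : ℕ} (h : Runs F m n m') (hn : n ≤ n') :
    Runs F m n' m' :=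
  let ⟨t, ht, hr⟩ := h
  ⟨t, ht.trans hn, hr⟩

namespace Frag

/-- The fragment that does nothing. -/
def skip : Frag where
  Lbl := Empty
  entry := none
  code := Empty.elim

/-- Push one symbol. -/
def push (k : Stack) (a : Sym k) : Frag where
  Lbl := Unit
  entry := some ()
  code _ := .push k a none

/-- Pop one symbol and branch on it. -/
def pop (k : Stack) (b : Option (Sym k) → Frag) : Frag where
  Lbl := Option (Σ o, (b o).Lbl)
  entry := some none
  code
    | none => .pop k fun o => (b o).entry.elim none fun l => some (some ⟨o, l⟩)
    | some ⟨o, l⟩ => ((b o).code l).map fun x => x.elim none fun l => some (some ⟨o, l⟩)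

/-- Sequential composition. -/
def seq (F G : Frag) : Frag where
  Lbl := F.Lbl ⊕ G.Lbl
  entry := F.entry.elim (G.entry.elim none fun l => some (.inr l)) fun l => some (.inl l)
  code
    | .inl l => (F.code l).map fun x =>
        x.elim (G.entry.elim none fun l => some (.inr l)) fun l => some (.inl l)
    | .inr l => (G.code l).map fun x => x.elim none fun l => some (.inr l)

/-- As long as stack `k` is nonempty, pop one symbol and run the corresponding body. -/
def loop (k : Stack) (b : Sym k → Frag) : Frag where
  Lbl := Option (Σ a, (b a).Lbl)
  entry := some none
  code
    | none => .pop k fun o => o.elim none fun a =>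
        (b a).entry.elim (some none) fun l => some (some ⟨a, l⟩)
    | some ⟨a, l⟩ => ((b a).code l).map fun x =>
        x.elim (some none) fun l => some (some ⟨a, l⟩)

end Frag

open Frag

theorem runs_skip (m : Mem) : Runs skip m 0 m := ⟨0, le_rfl, .refl _⟩

theorem runs_push (k : Stack) (a : Sym k) (m : Mem) :
    Runs (push k a) m 1 (Function.update m k (a :: m k)) :=
  ⟨1, le_rfl, .step (.refl _)⟩

theorem runs_pop {k : Stack} {b : Option (Sym k) → Frag} {m m' : Mem} {n : ℕ}
    (h : Runs (b (m k).head?) (Function.update m k (m k).tail) n m') :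
    Runs (pop k b) m (n + 1) m' := by
  obtain ⟨t, ht, hr⟩ := h
  refine ⟨t + 1, by omega, .step ?_⟩
  exact hr.embed (G := pop k b) (fun l => some ⟨_, l⟩) none fun l => rfl

theorem runs_seq {F G : Frag} {m m' m'' : Mem} {n n' : ℕ}
    (h : Runs F m n m') (h' : Runs G m' n' m'') : Runs (seq F G) m (n + n') m'' := by
  obtain ⟨t, ht, hr⟩ := h
  obtain ⟨t', ht', hr'⟩ := h'
  refine ⟨t + t', by omega, ?_⟩
  have h1 := hr.embed (G := seq F G) .inl (G.entry.elim none fun l => some (.inr l)) fun l => rfl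
  have h2 := hr'.embed (G := seq F G) .inr none fun l => rfl
  exact h1.trans h2

theorem runs_loop_nil {k : Stack} {b : Sym k → Frag} {m : Mem} (hm : m k = []) :
    Runs (loop k b) m 1 m := by
  refine ⟨1, le_rfl, .step ?_⟩
  have : ((loop k b).code none).exec m = (none, m) := by
    simp only [loop, Instr.exec, hm, List.head?_nil, List.tail_nil, Option.elim_none]
    rw [← hm, Function.update_eq_self]
  rw [this]
  exact .refl _

theorem runs_loop_cons {k : Stack} {b : Sym k → Frag} {m m' m'' : Mem} {a : Sym k}
    {s : List (Sym k)} {n n' : ℕ} (hm : m k = a :: s)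
    (h : Runs (b a) (Function.update m k s) n m') (h' : Runs (loop k b) m' n' m'') :
    Runs (loop k b) m (n' + n + 1) m'' := by
  obtain ⟨t, ht, hr⟩ := h
  obtain ⟨t', ht', hr'⟩ := h'
  refine ⟨t + t' + 1, by omega, .step ?_⟩
  have h1 := hr.embed (G := loop k b) (fun l => some ⟨_, l⟩) (some none) fun l => rfl
  have : ((loop k b).code none).exec m =
      ((b a).entry.elim (some none) fun l => some (some ⟨a, l⟩), Function.update m k s) := by
    simp [loop, Instr.exec, hm]
  rw [this]
  exact h1.trans hr'

/-! ### From fragments to Turing machines -/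

/-- Recover the symbol popped from stack `k` from the internal state. -/
def popped (k : Stack) (v : Σ k, Option (Sym k)) : Option (Sym k) :=
  if h : v.1 = k then h ▸ v.2 else none

theorem popped_mk (k : Stack) (o : Option (Sym k)) : popped k ⟨k, o⟩ = o := by simp [popped]

/-- The initial internal state of the machine. -/
def initState : Σ k, Option (Sym k) := ⟨.out, none⟩

/-- The statement of a Turing machine for an instruction. -/
def Instr.stmt {L : Type} : Instr L → Turing.TM2.Stmt Sym L (Σ k, Option (Sym k))
  | .push k a n => .push k (fun _ => a) (.goto fun _ => n)
  -- A jump can depend only on the internal state, so the popped symbol is stored there together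
  -- with the name of its stack.
  | .pop k n => .pop k (fun _ o => ⟨k, o⟩) (.goto fun v => n (popped k v))

/-- The Turing machine of a fragment. -/
def Frag.toTM (F : Frag) : Turing.FinTM2 where
  K := Stack
  k₀ := .inp
  k₁ := .out
  Γ := Sym
  Λ := Option F.Lbl
  main := F.entry
  σ := Σ k, Option (Sym k)
  initialState := initState
  m
    -- A halting configuration must carry the initial internal state; the exit label restores it.
    | none => .load (fun _ => initState) .halt
    | some l => (F.code l).stmt

/-- The new internal state can stay existential: a jump reads it only right after a pop has
overwritten it, so its earlier value never influences a run. -/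
theorem step_stmt {L : Type} (M : L → Turing.TM2.Stmt Sym L (Σ k, Option (Sym k)))
    (l : L) (c : Instr L) (h : M l = c.stmt) (v : Σ k, Option (Sym k)) (m : Mem) :
    ∃ v', Turing.TM2.step M ⟨some l, v, m⟩ = some ⟨some (c.exec m).1, v', (c.exec m).2⟩ := by
  cases c with
  | push k a n => exact ⟨v, by simp [Turing.TM2.step, h, Instr.stmt, Instr.exec]⟩
  | pop k n =>
    exact ⟨⟨k, (m k).head?⟩, by
      simp [Turing.TM2.step, h, Instr.stmt, Instr.exec, popped_mk]⟩

theorem Reach.toTM {F : Frag} {n c c'} (h : Reach F n c c') (v : Σ k, Option (Sym k)) :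
    ∃ v', (flip bind F.toTM.step)^[n] (some ⟨some c.1, v, c.2⟩) = some ⟨some c'.1, v', c'.2⟩ := by
  induction h generalizing v with
  | refl c => exact ⟨v, rfl⟩
  | @step l m n c _ ih =>
    obtain ⟨v₁, h₁⟩ := step_stmt F.toTM.m (some l) (F.code l) rfl v m
    obtain ⟨v₂, h₂⟩ := ih v₁
    refine ⟨v₂, ?_⟩
    rw [Function.iterate_succ_apply]
    refine Eq.trans ?_ h₂
    congr 1

/-- A fragment that moves from the input word to the output of a Boolean in polynomial time
solves the decision problem in polynomial time. -/
theorem solvable_of_frag {α : Type} (enc : α → List Letter) (P : α → Prop) (F : Frag)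
    (p : Polynomial ℕ) (b : α → Bool) (hb : ∀ a, b a = true ↔ P a)
    (h : ∀ a, Runs F (mem (enc a) [] [] [] [] []) (p.eval (enc a).length)
      (mem [] [b a] [] [] [] [])) :
    SolvableInPolyTime enc P := by
  classical
  refine ⟨{ tm := F.toTM, inputAlphabet := Equiv.refl _, outputAlphabet := Equiv.refl _,
            time := p + 1, outputsFun := fun a => ?_ }⟩
  apply Classical.choice
  obtain ⟨t, ht, hr⟩ := h a
  obtain ⟨v, hv⟩ := hr.toTM initState
  have hin : Turing.initList F.toTM (List.map (Equiv.refl Letter).invFun (enc a)) =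
      ⟨some F.entry, initState, mem (enc a) [] [] [] [] []⟩ := by
    simp only [Turing.initList]
    congr 1
    funext k
    cases k <;> first | rfl | (simp [Frag.toTM, mem]; rfl)
  have hout : Turing.haltList F.toTM (List.map (Equiv.refl Bool).invFun
      (Computability.encodeBool (decide (P a)))) =
      ⟨none, initState, mem [] [b a] [] [] [] []⟩ := by
    have : b a = decide (P a) := by rw [Bool.eq_iff_iff, hb]; simp
    simp only [Turing.haltList]
    congr 1
    funext k
    cases k <;> first | rfl | (simp [Frag.toTM, mem, this, Computability.encodeBool]; rfl)
  -- The extra step executes the exit label; it accounts for the summand 1 in `time`.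
  refine ⟨⟨⟨t + 1, ?_⟩, ?_⟩⟩
  · rw [Function.iterate_succ_apply']
    refine Eq.trans ?_ (congrArg some hout.symm)
    refine Eq.trans (congrArg (fun c => flip bind F.toTM.step ((flip bind F.toTM.step)^[t]
      (some c))) hin) ?_
    exact congrArg (flip bind F.toTM.step) hv
  · simp; omega

/-! ### Data and their representation -/

/-- Binary trees, the universal data type. -/
inductive Tree
  | nil
  | node (a b : Tree)

/-- The word of a tree, in prefix notation. -/
def Tree.word : Tree → List Bool
  | nil => [false]
  | node a b => true :: (a.word ++ b.word)

/-- A type whose elements are represented by trees. -/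
class Data (α : Type) where
  tree : α → Tree

section
variable {α β γ δ : Type} [Data α] [Data β] [Data γ] [Data δ]

instance : Data Unit := ⟨fun _ => .nil⟩
instance : Data Bool := ⟨fun b => if b then .node .nil .nil else .nil⟩
instance : Data (α × β) := ⟨fun p => .node (Data.tree p.1) (Data.tree p.2)⟩

/-- The tree of a list. -/
def listTree : List α → Tree
  | [] => .nil
  | a :: l => .node (Data.tree a) (listTree l)

instance : Data (List α) := ⟨listTree⟩

/-- The word that represents `a`. -/
def word (a : α) : List Bool := (Data.tree a).word

/-- The size of the representation of `a`. -/
def sz (a : α) : ℕ := (word a).length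

@[simp] theorem word_unit (u : Unit) : word u = [false] := rfl
@[simp] theorem word_false : word false = [false] := rfl
@[simp] theorem word_true : word true = [true, false, false] := rfl
@[simp] theorem word_pair (p : α × β) : word p = true :: (word p.1 ++ word p.2) := rfl
@[simp] theorem word_nil : word ([] : List α) = [false] := rfl
@[simp] theorem word_cons (a : α) (l : List α) : word (a :: l) = true :: (word a ++ word l) := rfl

@[simp] theorem sz_unit (u : Unit) : sz u = 1 := rfl
theorem sz_bool_le (b : Bool) : sz b ≤ 3 := by cases b <;> simp [sz]
theorem sz_pair (p : α × β) : sz p = sz p.1 + sz p.2 + 1 := by simp [sz]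
@[simp] theorem sz_nil : sz ([] : List α) = 1 := rfl
theorem sz_cons (a : α) (l : List α) : sz (a :: l) = sz a + sz l + 1 := by simp [sz]

theorem Tree.word_length_pos (t : Tree) : 0 < t.word.length := by cases t <;> simp [Tree.word]

theorem sz_pos (a : α) : 0 < sz a := Tree.word_length_pos _

/-! ### Polynomially bounded functions -/

/-- `h` is bounded by a polynomial in the size of its argument. -/
def PBdd (h : α → ℕ) : Prop := ∃ p : Polynomial ℕ, ∀ a, h a ≤ p.eval (sz a)

/-- The coefficients are natural numbers, so every monomial is monotone. -/
theorem eval_mono (p : Polynomial ℕ) {m n : ℕ} (h : m ≤ n) : p.eval m ≤ p.eval n := by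
  simp only [Polynomial.eval_eq_sum, Polynomial.sum]
  gcongr

theorem PBdd.mono {g h : α → ℕ} (hh : PBdd h) (H : ∀ a, g a ≤ h a) : PBdd g :=
  let ⟨p, hp⟩ := hh
  ⟨p, fun a => (H a).trans (hp a)⟩

theorem PBdd.const (n : ℕ) : PBdd fun _ : α => n := ⟨.C n, fun a => by simp⟩

theorem PBdd.size : PBdd fun a : α => sz a := ⟨.X, fun a => by simp⟩

theorem PBdd.add {g h : α → ℕ} (hg : PBdd g) (hh : PBdd h) : PBdd fun a => g a + h a :=
  let ⟨p, hp⟩ := hg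
  let ⟨q, hq⟩ := hh
  ⟨p + q, fun a => by simpa using Nat.add_le_add (hp a) (hq a)⟩

theorem PBdd.mul {g h : α → ℕ} (hg : PBdd g) (hh : PBdd h) : PBdd fun a => g a * h a :=
  let ⟨p, hp⟩ := hg
  let ⟨q, hq⟩ := hh
  ⟨p * q, fun a => by simpa using Nat.mul_le_mul (hp a) (hq a)⟩

theorem PBdd.eval (p : Polynomial ℕ) {h : α → ℕ} (hh : PBdd h) : PBdd fun a => p.eval (h a) :=
  let ⟨q, hq⟩ := hh
  ⟨p.comp q, fun a => by simpa using eval_mono p (hq a)⟩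

theorem PBdd.comp {h : β → ℕ} (hh : PBdd h) {f : α → β} (hf : PBdd fun a => sz (f a)) :
    PBdd fun a => h (f a) :=
  let ⟨p, hp⟩ := hh
  (PBdd.eval p hf).mono fun a => hp (f a)

/-! ### Functions computable in polynomial time -/

/-- The memory with only the work stack in use. -/
abbrev work (s : List Bool) : Mem := mem [] [] s [] [] []

/-- `f` is computable in polynomial time by a fragment that replaces its argument on top of the
work stack by the value. -/
def PTime (f : α → β) : Prop :=
  (∃ (F : Frag) (h : α → ℕ), PBdd h ∧
    -- Uniformity in the rest `s` of the stack lets the fragment serve as a subroutine above other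
    -- data. The size bound on values, carried separately, is what composition needs.
    ∀ a s, Runs F (work (word a ++ s)) (h a) (work (word (f a) ++ s))) ∧
  PBdd fun a => sz (f a)

theorem PTime.bdd {f : α → β} (h : PTime f) : PBdd fun a => sz (f a) := h.2

/-- The empty program performs every retyping: a nonempty list has the tree of the pair of its head
and tail, and a letter has the tree of its unary code. -/
theorem PTime.of_same_word {f : α → β} (h : ∀ a, word (f a) = word a) : PTime f :=
  ⟨⟨skip, fun _ => 0, .const 0, fun a s => by rw [h]; exact runs_skip _⟩,
    PBdd.size.mono fun a => by simp [sz, h]⟩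

theorem PTime.id : PTime fun a : α => a := .of_same_word fun _ => rfl

theorem PTime.comp {g : β → γ} {f : α → β} (hg : PTime g) (hf : PTime f) :
    PTime fun a => g (f a) := by
  obtain ⟨⟨G, k, hk, hG⟩, bg⟩ := hg
  obtain ⟨⟨F, h, hh, hF⟩, bf⟩ := hf
  exact ⟨⟨seq F G, fun a => h a + k (f a), hh.add (hk.comp bf),
    fun a s => runs_seq (hF a s) (hG (f a) s)⟩, bg.comp bf⟩

/-! ### Moving words between the stacks -/

section
variable {i : List Letter} {o s f l r : List Bool}

theorem runs_push_main (a : Bool) :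
    Runs (push .main a) (mem i o s f l r) 1 (mem i o (a :: s) f l r) := by
  simpa using runs_push .main a (mem i o s f l r)

theorem runs_push_flag (a : Bool) :
    Runs (push .flag a) (mem i o s f l r) 1 (mem i o s (a :: f) l r) := by
  simpa using runs_push .flag a (mem i o s f l r)

theorem runs_push_left (a : Bool) :
    Runs (push .left a) (mem i o s f l r) 1 (mem i o s f (a :: l) r) := by
  simpa using runs_push .left a (mem i o s f l r)

theorem runs_push_right (a : Bool) :
    Runs (push .right a) (mem i o s f l r) 1 (mem i o s f l (a :: r)) := by
  simpa using runs_push .right a (mem i o s f l r)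

theorem runs_push_out (a : Bool) :
    Runs (push .out a) (mem i o s f l r) 1 (mem i (a :: o) s f l r) := by
  simpa using runs_push .out a (mem i o s f l r)

theorem runs_pop_main {b : Option Bool → Frag} {a : Bool} {m' : Mem} {n : ℕ}
    (h : Runs (b (some a)) (mem i o s f l r) n m') :
    Runs (pop .main b) (mem i o (a :: s) f l r) (n + 1) m' :=
  runs_pop (by simpa using h)

/-- Push a word so that its first symbol ends on top. -/
def pushWord : List Bool → Frag
  | [] => skip
  | a :: w => seq (pushWord w) (push .main a)

theorem runs_pushWord (w : List Bool) :
    Runs (pushWord w) (mem i o s f l r) w.length (mem i o (w ++ s) f l r) := by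
  induction w with
  | nil => exact runs_skip _
  | cons a w ih => exact runs_seq ih (runs_push_main a)

/-- The loop body for moving the top tree of the work stack, one symbol at a time, by `p`; the flag
stack counts the subtrees still to be moved. -/
def takeBody (p : Bool → Frag) : Bool → Frag := fun _ =>
  pop .main fun
    | some true => seq (push .flag true) (seq (push .flag true) (p true))
    | some false => p false
    | none => skip

/-- Prefix notation is self-delimiting: a leaf settles one pending subtree, while a node replaces
one by two. The induction needs the remainder of the loop as a hypothesis, since moving a subtree
does not end the loop. A symbol costs at most five steps: two pops and three pushes. -/
theorem runs_takeLeft (t : Tree) : ∀ {s f l : List Bool} {n : ℕ} {m' : Mem},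
    Runs (loop .flag (takeBody (push .left))) (mem i o s f (t.word.reverse ++ l) r) n m' →
    Runs (loop .flag (takeBody (push .left))) (mem i o (t.word ++ s) (true :: f) l r)
      (n + 5 * t.word.length) m' := by
  induction t with
  | nil =>
    intro s f l n m' h
    refine Runs.mono (runs_loop_cons (s := f) rfl ?_ h) (n := n + 2 + 1) (by simp [Tree.word])
    simp only [update_flag]
    exact runs_pop_main (runs_push_left false)
  | node a b iha ihb =>
    intro s f l n m' h
    have h1 := @ihb s f (a.word.reverse ++ true :: l) n m' (by simpa [Tree.word] using h)
    have h2 := @iha (b.word ++ s) (true :: f) (true :: l) _ m' h1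
    refine Runs.mono (runs_loop_cons (s := f) rfl (n := 4) ?_ h2) (by simp [Tree.word]; omega)
    simp only [update_flag, Tree.word, List.cons_append, List.append_assoc]
    exact runs_pop_main (runs_seq (runs_push_flag _) (runs_seq (runs_push_flag _)
      (runs_push_left _)))

theorem runs_takeRight (t : Tree) : ∀ {s f r : List Bool} {n : ℕ} {m' : Mem},
    Runs (loop .flag (takeBody (push .right))) (mem i o s f l (t.word.reverse ++ r)) n m' →
    Runs (loop .flag (takeBody (push .right))) (mem i o (t.word ++ s) (true :: f) l r)
      (n + 5 * t.word.length) m' := by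
  induction t with
  | nil =>
    intro s f r n m' h
    refine Runs.mono (runs_loop_cons (s := f) rfl ?_ h) (n := n + 2 + 1) (by simp [Tree.word])
    simp only [update_flag]
    exact runs_pop_main (runs_push_right false)
  | node a b iha ihb =>
    intro s f r n m' h
    have h1 := @ihb s f (a.word.reverse ++ true :: r) n m' (by simpa [Tree.word] using h)
    have h2 := @iha (b.word ++ s) (true :: f) (true :: r) _ m' h1
    refine Runs.mono (runs_loop_cons (s := f) rfl (n := 4) ?_ h2) (by simp [Tree.word]; omega)
    simp only [update_flag, Tree.word, List.cons_append, List.append_assoc]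
    exact runs_pop_main (runs_seq (runs_push_flag _) (runs_seq (runs_push_flag _)
      (runs_push_right _)))

end

end

section
variable {i : List Letter} {o s f l r : List Bool}

/-- Move the top tree of the work stack to the left stack, reversing it. -/
def takeLeft : Frag := seq (push .flag true) (loop .flag (takeBody (push .left)))

/-- Move the top tree of the work stack to the right stack, reversing it. -/
def takeRight : Frag := seq (push .flag true) (loop .flag (takeBody (push .right)))

theorem runs_takeLeft' {α : Type} [Data α] (a : α) :
    Runs takeLeft (mem i o (word a ++ s) [] l r) (5 * sz a + 2)
      (mem i o s [] ((word a).reverse ++ l) r) := by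
  refine (runs_seq (runs_push_flag true) (runs_takeLeft _ (runs_loop_nil rfl))).mono ?_
  simp only [sz, word]; omega

theorem runs_takeRight' {α : Type} [Data α] (a : α) :
    Runs takeRight (mem i o (word a ++ s) [] l r) (5 * sz a + 2)
      (mem i o s [] l ((word a).reverse ++ r)) := by
  refine (runs_seq (runs_push_flag true) (runs_takeRight _ (runs_loop_nil rfl))).mono ?_
  simp only [sz, word]; omega

theorem runs_unloadLeft : Runs (loop .left fun a => push .main a) (mem i o s f l r)
    (2 * l.length + 1) (mem i o (l.reverse ++ s) f [] r) := by
  induction l generalizing s with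
  | nil => exact runs_loop_nil rfl
  | cons a l ih =>
    refine (runs_loop_cons (s := l) rfl ?_ (by simpa using ih (s := a :: s))).mono
      (n := 2 * l.length + 1 + 1 + 1) (by simp; omega)
    simpa using runs_push_main a

theorem runs_unloadRight : Runs (loop .right fun a => push .main a) (mem i o s f l r)
    (2 * r.length + 1) (mem i o (r.reverse ++ s) f l []) := by
  induction r generalizing s with
  | nil => exact runs_loop_nil rfl
  | cons a r ih =>
    refine (runs_loop_cons (s := r) rfl ?_ (by simpa using ih (s := a :: s))).mono
      (n := 2 * r.length + 1 + 1 + 1) (by simp; omega)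
    simpa using runs_push_main a

theorem runs_rightToLeft : Runs (loop .right fun a => push .left a) (mem i o s f l r)
    (2 * r.length + 1) (mem i o s f (r.reverse ++ l) []) := by
  induction r generalizing l with
  | nil => exact runs_loop_nil rfl
  | cons a r ih =>
    refine (runs_loop_cons (s := r) rfl ?_ (by simpa using ih (l := a :: l))).mono
      (n := 2 * r.length + 1 + 1 + 1) (by simp; omega)
    simpa using runs_push_left a

theorem runs_copyLeft :
    Runs (loop .left fun a => seq (push .main a) (push .right a)) (mem i o s f l r)
      (3 * l.length + 1) (mem i o (l.reverse ++ s) f [] (l.reverse ++ r)) := by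
  induction l generalizing s r with
  | nil => exact runs_loop_nil rfl
  | cons a l ih =>
    refine (runs_loop_cons (s := l) rfl ?_ (by simpa using ih (s := a :: s) (r := a :: r))).mono
      (n := 3 * l.length + 1 + 2 + 1) (by simp; omega)
    simpa using runs_seq (runs_push_main a) (runs_push_right a)

theorem runs_clearLeft : Runs (loop .left fun _ => skip) (mem i o s f l r)
    (l.length + 1) (mem i o s f [] r) := by
  induction l with
  | nil => exact runs_loop_nil rfl
  | cons a l ih =>
    refine (runs_loop_cons (s := l) rfl ?_ ih).mono
      (n := l.length + 1 + 0 + 1) (by simp)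
    simpa using runs_skip _

/-- Remove the top tree of the work stack. -/
def drop : Frag := seq takeLeft (loop .left fun _ => skip)

/-- Duplicate the top tree of the work stack. -/
def dup : Frag :=
  seq takeLeft (seq (loop .left fun a => seq (push .main a) (push .right a))
    (seq (loop .right fun a => push .left a) (loop .left fun a => push .main a)))

/-- Exchange the two top trees of the work stack. -/
def swap : Frag :=
  seq takeLeft (seq takeRight (seq (loop .left fun a => push .main a)
    (loop .right fun a => push .main a)))

variable {α β γ : Type} [Data α] [Data β] [Data γ]

theorem runs_drop (a : α) : Runs drop (work (word a ++ s)) (6 * sz a + 3) (work s) := by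
  refine (runs_seq (runs_takeLeft' a) runs_clearLeft).mono ?_
  simp [sz]; omega

theorem runs_dup (a : α) :
    Runs dup (work (word a ++ s)) (12 * sz a + 5) (work (word a ++ (word a ++ s))) := by
  refine (runs_seq (runs_takeLeft' a) (runs_seq runs_copyLeft (runs_seq runs_rightToLeft
    (by simpa using runs_unloadLeft (l := (word a).reverse))))).mono ?_
  simp [sz]; omega

theorem runs_swap (a : α) (b : β) : Runs swap (work (word a ++ (word b ++ s)))
    (7 * sz a + 7 * sz b + 6) (work (word b ++ (word a ++ s))) := by
  refine (runs_seq (runs_takeLeft' a) (runs_seq (runs_takeRight' b) (runs_seq runs_unloadLeft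
    (by simpa using runs_unloadRight (r := (word b).reverse))))).mono ?_
  simp [sz]; omega

/-! ### Basic functions -/

theorem PTime.const (b : β) : PTime fun _ : α => b :=
  ⟨⟨seq drop (pushWord (word b)), fun a => 6 * sz a + 3 + sz b,
    (((PBdd.const 6).mul .size).add (.const 3)).add (.const _),
    fun a _ => runs_seq (runs_drop a) (runs_pushWord _)⟩, .const _⟩

theorem PTime.pair {f : α → β} {g : α → γ} (hf : PTime f) (hg : PTime g) :
    PTime fun a => (f a, g a) := by
  obtain ⟨⟨F, h, hh, hF⟩, bf⟩ := hf
  obtain ⟨⟨G, k, hk, hG⟩, bg⟩ := hg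
  -- From the top, the stack successively holds a, a; then g(a), a; then a, g(a); then f(a), g(a).
  -- The last push adds the marker of a pair.
  refine ⟨⟨seq dup (seq G (seq swap (seq F (push .main true)))),
    fun a => (12 * sz a + 5) + (k a + ((7 * sz (g a) + 7 * sz a + 6) + (h a + 1))),
    ?_, fun a s => ?_⟩, ?_⟩
  · exact (((PBdd.const 12).mul .size).add (.const 5)).add (hk.add
      (((((PBdd.const 7).mul bg).add ((PBdd.const 7).mul .size)).add (.const 6)).add
        (hh.add (.const 1))))
  · refine runs_seq (runs_dup a) (runs_seq (hG a _) (runs_seq (runs_swap _ _)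
      (runs_seq (hF a _) ?_)))
    simpa using runs_push_main true
  · exact ((bf.add bg).add (.const 1)).mono fun a => (sz_pair _).le

theorem PTime.fst : PTime fun p : α × β => p.1 := by
  refine ⟨⟨pop .main fun _ => seq swap drop,
    fun p => (7 * sz p + 7 * sz p + 6) + (6 * sz p + 3) + 1, ?_, fun p s => ?_⟩, ?_⟩
  · exact ((((((PBdd.const 7).mul .size).add ((PBdd.const 7).mul .size)).add (.const 6)).add
      (((PBdd.const 6).mul .size).add (.const 3))).add (.const 1))
  · rw [word_pair, List.cons_append, List.append_assoc]
    refine (runs_pop_main (runs_seq (runs_swap p.1 p.2) (runs_drop p.2))).mono ?_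
    have := sz_pair p; dsimp only; omega
  · exact PBdd.size.mono fun p => by have := sz_pair p; dsimp only; omega

theorem PTime.snd : PTime fun p : α × β => p.2 := by
  refine ⟨⟨pop .main fun _ => drop, fun p => (6 * sz p + 3) + 1, ?_, fun p s => ?_⟩, ?_⟩
  · exact ((((PBdd.const 6).mul .size).add (.const 3))).add (.const 1)
  · rw [word_pair, List.cons_append, List.append_assoc]
    refine (runs_pop_main (runs_drop p.1)).mono ?_
    have := sz_pair p; dsimp only; omega
  · exact PBdd.size.mono fun p => by have := sz_pair p; dsimp only; omega

theorem PTime.cond {c : α → Bool} {f g : α → β} (hc : PTime c) (hf : PTime f) (hg : PTime g) :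
    PTime fun a => bif c a then f a else g a := by
  obtain ⟨⟨C, j, hj, hC⟩, -⟩ := hc
  obtain ⟨⟨F, h, hh, hF⟩, bf⟩ := hf
  obtain ⟨⟨G, k, hk, hG⟩, bg⟩ := hg
  refine ⟨⟨seq dup (seq C (pop .main fun
      -- The word of `true` has three symbols, of which two are still on the stack.
      | some true => pop .main fun _ => pop .main fun _ => F
      | _ => G)),
    fun a => (12 * sz a + 5) + (j a + (h a + k a + 3)), ?_, fun a s => ?_⟩, ?_⟩
  · exact (((PBdd.const 12).mul .size).add (.const 5)).add (hj.add ((hh.add hk).add (.const 3)))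
  · refine runs_seq (runs_dup a) (runs_seq (hC a _) ?_)
    dsimp only
    cases c a
    · exact (runs_pop_main (hG a s)).mono (n := k a + 1) (by omega)
    · exact (runs_pop_main (runs_pop_main (runs_pop_main (hF a s)))).mono
        (n := h a + 1 + 1 + 1) (by omega)
  · exact (bf.add bg).mono fun a => by cases h : c a <;> simp [h]

theorem PTime.ite {c : α → Prop} [∀ a, Decidable (c a)] {f g : α → β}
    (hc : PTime fun a => decide (c a)) (hf : PTime f) (hg : PTime g) :
    PTime fun a => if c a then f a else g a := by
  have : (fun a => if c a then f a else g a) = fun a => bif decide (c a) then f a else g a := by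
    funext a; by_cases h : c a <;> simp [h]
  rw [this]
  exact .cond hc hf hg

theorem PTime.cons {f : α → β} {g : α → List β} (hf : PTime f) (hg : PTime g) :
    PTime fun a => f a :: g a :=
  (PTime.of_same_word (f := fun p : β × List β => p.1 :: p.2) fun _ => rfl).comp (hf.pair hg)

theorem PTime.isEmpty {f : α → List β} (hf : PTime f) : PTime fun a => (f a).isEmpty := by
  refine PTime.comp (g := List.isEmpty) ?_ hf
  refine ⟨⟨pop .main fun
      | some true => seq drop (seq drop (push .main false))
      | _ => pushWord (word true), fun l => 6 * sz l + 3 + (6 * sz l + 3 + 1) + 3, ?_,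
    fun l s => ?_⟩, (PBdd.const 3).mono fun _ => sz_bool_le _⟩
  · exact ((((PBdd.const 6).mul .size).add (.const 3)).add
      ((((PBdd.const 6).mul .size).add (.const 3)).add (.const 1))).add (.const 3)
  · cases l with
    | nil => exact (runs_pop_main (runs_pushWord (word true))).mono (by simp [word_true])
    | cons a l =>
      rw [word_cons, List.cons_append, List.append_assoc]
      refine (runs_pop_main (runs_seq (runs_drop a) (runs_seq (runs_drop l)
        (runs_push_main false)))).mono ?_
      have := sz_cons a l; dsimp only; omega

theorem PTime.tail {f : α → List β} (hf : PTime f) : PTime fun a => (f a).tail := by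
  refine PTime.comp (g := List.tail) ?_ hf
  refine ⟨⟨pop .main fun
      | some true => drop
      | _ => push .main false, fun l => 6 * sz l + 3 + 1, ?_, fun l s => ?_⟩, ?_⟩
  · exact (((PBdd.const 6).mul .size).add (.const 3)).add (.const 1)
  · cases l with
    | nil => exact (runs_pop_main (runs_push_main false)).mono (by dsimp only; omega)
    | cons a l =>
      rw [word_cons, List.cons_append, List.append_assoc]
      refine (runs_pop_main (runs_drop a)).mono ?_
      have := sz_cons a l; dsimp only; omega
  · refine PBdd.size.mono fun l => ?_
    cases l
    · exact le_rfl
    · simp only [sz_cons, List.tail_cons]; omega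

theorem PTime.headD {f : α → List β} (hf : PTime f) (b : β) : PTime fun a => (f a).headD b := by
  refine PTime.comp (g := fun l => List.headD l b) ?_ hf
  refine ⟨⟨pop .main fun
      | some true => seq swap drop
      | _ => pushWord (word b), fun l => (14 * sz l + 6) + (6 * sz l + 3) + sz b + 1, ?_,
    fun l s => ?_⟩, ?_⟩
  · exact (((((PBdd.const 14).mul .size).add (.const 6)).add
      (((PBdd.const 6).mul .size).add (.const 3))).add (.const _)).add (.const 1)
  · cases l with
    | nil => exact (runs_pop_main (runs_pushWord (word b))).mono (by simp only [sz]; omega)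
    | cons a l =>
      rw [word_cons, List.cons_append, List.append_assoc]
      refine (runs_pop_main (runs_seq (runs_swap a l) (runs_drop l))).mono ?_
      have := sz_cons a l; dsimp only; omega
  · refine (PBdd.size.add (.const (sz b))).mono fun l => ?_
    cases l
    · exact Nat.le_add_left _ _
    · simp only [sz_cons, List.headD_cons]; omega

/-! ### Recursion on lists -/

/-- Iterate `F` on pairs of a list and a state until the list is empty. -/
def foldLoop (F : Frag) : Frag :=
  loop .flag fun _ => pop .main fun _ => pop .main fun
    | some true => seq (push .main true) (seq (push .main true) (seq F (push .flag true)))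
    | _ => skip

/-- The single flag keeps the loop alive and is absent while `F` runs. Each round inspects the
markers of the pair and of the list; for a nonempty list both are put back, so that `F` finds a
well-formed argument, and for the empty list their removal leaves just the state. Bounding all
intermediate states by `q` bounds every round by the same number of steps. -/
theorem runs_foldLoop {step : β → α → β} {F : Frag} {p : Polynomial ℕ}
    (hF : ∀ (a : α) (l : List α) (b : β) (s : List Bool),
      Runs F (work (word (a :: l, b) ++ s)) (p.eval (sz (a :: l, b)))
        (work (word (l, step b a) ++ s)))
    (q : ℕ) (s : List Bool) : ∀ (l : List α) (b : β),
      (∀ l', l' <+: l → sz (l'.foldl step b) ≤ q) →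
      Runs (foldLoop F) (mem [] [] (word (l, b) ++ s) [true] [] [])
        ((l.length + 1) * (p.eval (sz l + q + 1) + 6)) (work (word (l.foldl step b) ++ s)) := by
  intro l
  induction l with
  | nil =>
    intro b _
    refine (runs_loop_cons (s := []) rfl (n := 2) ?_ (runs_loop_nil rfl)).mono ?_
    · simp only [update_flag]
      exact runs_pop_main (runs_pop_main (runs_skip _))
    · simp
  | cons a l ih =>
    intro b hb
    have h0 := hb [] (List.nil_prefix)
    have h1 := ih (step b a) fun l' h => hb (a :: l') (List.cons_prefix_cons.2 ⟨rfl, h⟩)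
    have h2 := hF a l b s
    refine (runs_loop_cons (s := []) rfl (n := p.eval (sz (a :: l, b)) + 5) ?_ h1).mono ?_
    · simp only [update_flag]
      simp only [word_pair, word_cons, List.cons_append] at h2 ⊢
      refine (runs_pop_main (runs_pop_main (runs_seq (runs_push_main true)
        (runs_seq (runs_push_main true) (runs_seq h2 (runs_push_flag true)))))).mono ?_
      omega
    · have e1 : p.eval (sz (a :: l, b)) ≤ p.eval (sz (a :: l) + q + 1) :=
        eval_mono p (by rw [sz_pair]; simp only [List.foldl_nil] at h0; dsimp only; omega)
      have e2 : p.eval (sz l + q + 1) ≤ p.eval (sz (a :: l) + q + 1) :=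
        eval_mono p (by rw [sz_cons]; omega)
      have e3 : (l.length + 1) * (p.eval (sz l + q + 1) + 6) ≤
          (l.length + 1) * (p.eval (sz (a :: l) + q + 1) + 6) :=
        Nat.mul_le_mul_left _ (by omega)
      rw [List.length_cons, Nat.succ_mul (l.length + 1)]
      omega

theorem length_le_sz (l : List α) : l.length ≤ sz l := by
  induction l with
  | nil => simp
  | cons a l ih => rw [sz_cons, List.length_cons]; omega

/-- Left folds are computable in polynomial time if the sizes of all intermediate values are
polynomially bounded. -/
theorem PTime.foldl {l : γ → List α} {i : γ → β} {step : γ → β → α → β} (hl : PTime l)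
    (hi : PTime i) (hs : PTime fun p : (γ × β) × α => step p.1.1 p.1.2 p.2)
    {B : γ → ℕ} (hB : PBdd B)
    (hb : ∀ c l', l' <+: l c → sz (l'.foldl (step c) (i c)) ≤ B c) :
    PTime fun c => (l c).foldl (step c) (i c) := by
  -- The parameter travels with the state, because the loop body sees nothing else.
  have hbody : PTime fun x : (α × List α) × (γ × β) =>
      (x.1.2, (x.2.1, step x.2.1 x.2.2 x.1.1)) :=
    (PTime.snd.comp .fst).pair ((PTime.fst.comp .snd).pair
      (hs.comp (f := fun x : (α × List α) × (γ × β) => (x.2, x.1.1))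
        (PTime.snd.pair (PTime.fst.comp .fst))))
  obtain ⟨⟨F, h, ⟨p, hp⟩, hF⟩, -⟩ := hbody
  have hF' : ∀ (a : α) (l : List α) (b : γ × β) (s : List Bool),
      Runs F (work (word (a :: l, b) ++ s)) (p.eval (sz (a :: l, b)))
        (work (word (l, (fun (b : γ × β) a => (b.1, step b.1 b.2 a)) b a) ++ s)) :=
    -- The pair `(a, l)` and the list `a :: l` have the same word, so the program applies to the
    -- state of the loop unchanged.
    fun a l b s => (hF ((a, l), b) s).mono (hp ((a, l), b))
  have hfold : ∀ (c : γ) (b : β) (l : List α),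
      l.foldl (fun (b : γ × β) a => (b.1, step b.1 b.2 a)) (c, b) = (c, l.foldl (step c) b) := by
    intro c b l
    induction l generalizing b with
    | nil => rfl
    | cons a l ih => exact ih _
  refine PTime.comp (g := fun x : γ × β => x.2)
    (f := fun c => (c, (l c).foldl (step c) (i c))) .snd ?_
  have bB : PBdd fun c => sz c + B c + 1 := (PBdd.size.add hB).add (.const 1)
  obtain ⟨⟨I, k, hk, hI⟩, -⟩ := hl.pair (PTime.id.pair hi)
  refine ⟨⟨seq I (seq (push .flag true) (foldLoop F)),
    fun c => k c + (1 + (sz (l c) + 1) * (p.eval (sz (l c) + (sz c + B c + 1) + 1) + 6)),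
    ?_, fun c s => ?_⟩, bB.mono fun c => ?_⟩
  · exact hk.add ((PBdd.const 1).add ((hl.bdd.add (.const 1)).mul
      ((PBdd.eval p ((hl.bdd.add bB).add (.const 1))).add (.const 6))))
  · have := runs_foldLoop hF' (sz c + B c + 1) s (l c) (c, i c) fun l' h => by
      rw [hfold, sz_pair]
      have := hb c l' h
      dsimp only; omega
    rw [hfold] at this
    refine (runs_seq (hI c s) (runs_seq (runs_push_flag true) this)).mono ?_
    have := length_le_sz (l c)
    dsimp only
    gcongr
  · rw [sz_pair]
    have := hb c (l c) List.prefix_rfl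
    dsimp only; omega

/-- Left folds in which each step increases the size by a bounded amount. -/
theorem PTime.foldl_add {l : γ → List α} {i : γ → β} {step : γ → β → α → β} (hl : PTime l)
    (hi : PTime i) (hs : PTime fun p : (γ × β) × α => step p.1.1 p.1.2 p.2)
    {B : γ → ℕ} (hB : PBdd B) (hb : ∀ c b, ∀ a ∈ l c, sz (step c b a) ≤ sz b + B c) :
    PTime fun c => (l c).foldl (step c) (i c) := by
  refine .foldl hl hi hs (B := fun c => sz (i c) + sz (l c) * B c)
    (hi.bdd.add (hl.bdd.mul hB)) fun c l' hl' => ?_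
  have key : ∀ (l' : List α) b, (∀ a ∈ l', a ∈ l c) →
      sz (l'.foldl (step c) b) ≤ sz b + l'.length * B c := by
    intro l'
    induction l' with
    | nil => intro b _; simp
    | cons a l' ih =>
      intro b h
      have h1 := ih (step c b a) fun x hx => h x (List.mem_cons_of_mem _ hx)
      have h2 := hb c b a (h a List.mem_cons_self)
      rw [List.foldl_cons, List.length_cons, Nat.succ_mul]
      omega
  refine (key l' (i c) fun a ha => hl'.subset ha).trans ?_
  have := (hl'.length_le).trans (length_le_sz (l c))
  gcongr

end

/-! ### Operations on lists in polynomial time -/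

section
variable {α β γ δ : Type} [Data α] [Data β] [Data γ] [Data δ]

theorem PTime.fst' {f : γ → α × β} (hf : PTime f) : PTime fun c => (f c).1 := PTime.fst.comp hf

theorem PTime.snd' {f : γ → α × β} (hf : PTime f) : PTime fun c => (f c).2 := PTime.snd.comp hf

theorem sz_lt_of_mem {a : α} {l : List α} (h : a ∈ l) : sz a < sz l := by
  induction l with
  | nil => cases h
  | cons b l ih =>
    rw [sz_cons]
    rcases List.mem_cons.1 h with rfl | h
    · omega
    · have := ih h; omega

theorem sz_append_le (l l' : List α) : sz (l ++ l') ≤ sz l + sz l' := by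
  induction l with
  | nil => simp
  | cons a l ih => rw [List.cons_append, sz_cons, sz_cons]; omega

theorem sz_tail_le (l : List α) : sz l.tail ≤ sz l := by
  cases l
  · exact le_rfl
  · rw [sz_cons, List.tail_cons]; omega

theorem sz_le_of_forall {l : List α} {M : ℕ} (h : ∀ a ∈ l, sz a ≤ M) :
    sz l ≤ l.length * (M + 1) + 1 := by
  induction l with
  | nil => simp
  | cons a l ih =>
    have h1 := h a List.mem_cons_self
    have h2 := ih fun x hx => h x (List.mem_cons_of_mem _ hx)
    rw [sz_cons, List.length_cons, Nat.succ_mul]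
    omega

theorem sz_bits_le (l : List Bool) : sz l ≤ 4 * l.length + 1 := by
  have := sz_le_of_forall (l := l) fun a _ => sz_bool_le a
  omega

/-- Left folds with an invariant that bounds the size. -/
theorem PTime.foldl_inv {l : γ → List α} {i : γ → β} {step : γ → β → α → β} (hl : PTime l)
    (hi : PTime i) (hs : PTime fun p : (γ × β) × α => step p.1.1 p.1.2 p.2)
    {B : γ → ℕ} (hB : PBdd B) (Inv : γ → ℕ → β → Prop) (h0 : ∀ c, Inv c 0 (i c))
    (h1 : ∀ c n b, ∀ a ∈ l c, Inv c n b → Inv c (n + 1) (step c b a))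
    (h2 : ∀ c n b, n ≤ (l c).length → Inv c n b → sz b ≤ B c) :
    PTime fun c => (l c).foldl (step c) (i c) := by
  refine .foldl hl hi hs hB fun c l' hl' => h2 c l'.length _ hl'.length_le ?_
  have hm : ∀ a ∈ l', a ∈ l c := fun a ha => hl'.subset ha
  clear hl'
  induction l' using List.reverseRecOn with
  | nil => exact h0 c
  | append_singleton l' a ih =>
    rw [List.foldl_append, List.length_append]
    exact h1 c _ _ a (hm a (by simp)) (ih fun x hx => hm x (by simp [hx]))

theorem PTime.reverse {l : γ → List α} (hl : PTime l) : PTime fun c => (l c).reverse := by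
  have h := PTime.foldl_add (step := fun (_ : γ) (b : List α) (a : α) => a :: b) hl (.const [])
    (.cons .snd PTime.fst.snd') (B := fun c => sz (l c) + 1) (hl.bdd.add (.const 1))
    fun c b a ha => by
      have := sz_lt_of_mem ha
      rw [sz_cons]; omega
  simpa using h

theorem PTime.append {l l' : γ → List α} (hl : PTime l) (hl' : PTime l') :
    PTime fun c => l c ++ l' c := by
  have h := PTime.foldl_add (step := fun (_ : γ) (b : List α) (a : α) => a :: b) hl.reverse hl'
    (.cons .snd PTime.fst.snd') (B := fun c => sz (l c) + 1) (hl.bdd.add (.const 1))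
    fun c b a ha => by
      have := sz_lt_of_mem (List.mem_reverse.1 ha)
      rw [sz_cons]; omega
  simpa using h

/-- An element is smaller than the list containing it, so the polynomial bounding the values of `f`
can be evaluated once at a size that covers all elements. -/
theorem PTime.mapBdd {l : γ → List α} {f : γ → α → β} (hl : PTime l)
    (hf : PTime fun p : γ × α => f p.1 p.2) :
    ∃ B : γ → ℕ, PBdd B ∧ ∀ c, ∀ a ∈ l c, sz (f c a) ≤ B c := by
  obtain ⟨q, hq⟩ := hf.bdd
  refine ⟨fun c => q.eval (sz c + sz (l c) + 1),
    PBdd.eval q ((PBdd.size.add hl.bdd).add (.const 1)), fun c a ha => ?_⟩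
  refine (hq (c, a)).trans (eval_mono q ?_)
  have := sz_lt_of_mem ha
  rw [sz_pair]; dsimp only; omega

theorem PTime.map {l : γ → List α} {f : γ → α → β} (hl : PTime l)
    (hf : PTime fun p : γ × α => f p.1 p.2) : PTime fun c => (l c).map (f c) := by
  obtain ⟨B, hB, hb⟩ := PTime.mapBdd hl hf
  have h := PTime.foldl_add (step := fun (c : γ) (b : List β) (a : α) => f c a :: b) hl (.const [])
    (.cons (hf.comp (f := fun p : (γ × List β) × α => (p.1.1, p.2)) (PTime.fst.fst'.pair .snd))
      PTime.fst.snd') (B := fun c => B c + 1) (hB.add (.const 1))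
    fun c b a ha => by
      have := hb c a ha
      rw [sz_cons]; omega
  have e : ∀ (c : γ) (l : List α) (b : List β),
      (l.foldl (fun (b : List β) (a : α) => f c a :: b) b).reverse = b.reverse ++ l.map (f c) := by
    simp
  simpa [e] using h.reverse

theorem PTime.flatMap {l : γ → List α} {f : γ → α → List β} (hl : PTime l)
    (hf : PTime fun p : γ × α => f p.1 p.2) : PTime fun c => (l c).flatMap (f c) := by
  obtain ⟨B, hB, hb⟩ := PTime.mapBdd hl hf
  have h := PTime.foldl_add (step := fun (c : γ) (b : List β) (a : α) => b ++ f c a) hl (.const [])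
    (.append PTime.fst.snd' (hf.comp (f := fun p : (γ × List β) × α => (p.1.1, p.2))
      (PTime.fst.fst'.pair .snd))) hB
    fun c b a ha => by
      have := hb c a ha
      exact (sz_append_le _ _).trans (by omega)
  have e : ∀ (c : γ) (l : List α) (b : List β),
      l.foldl (fun (b : List β) (a : α) => b ++ f c a) b = b ++ l.flatMap (f c) := by
    intro c l
    induction l with
    | nil => simp
    | cons a l ih => intro b; simp [ih]
  simpa [e] using h

theorem PTime.not {b : γ → Bool} (hb : PTime b) : PTime fun c => !b c := by
  have : (fun c => !b c) = fun c => bif b c then false else true := by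
    funext c; cases b c <;> rfl
  rw [this]
  exact .cond hb (.const _) (.const _)

theorem PTime.and {a b : γ → Bool} (ha : PTime a) (hb : PTime b) : PTime fun c => a c && b c := by
  have : (fun c => a c && b c) = fun c => bif a c then b c else false := by
    funext c; cases a c <;> rfl
  rw [this]
  exact .cond ha hb (.const _)

theorem PTime.or {a b : γ → Bool} (ha : PTime a) (hb : PTime b) : PTime fun c => a c || b c := by
  have : (fun c => a c || b c) = fun c => bif a c then true else b c := by
    funext c; cases a c <;> rfl
  rw [this]
  exact .cond ha (.const _) hb

theorem PTime.xor {a b : γ → Bool} (ha : PTime a) (hb : PTime b) : PTime fun c => a c ^^ b c := by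
  have : (fun c => a c ^^ b c) = fun c => bif a c then !b c else b c := by
    funext c; cases a c <;> simp
  rw [this]
  exact .cond ha hb.not hb

theorem PTime.all {l : γ → List α} {f : γ → α → Bool} (hl : PTime l)
    (hf : PTime fun p : γ × α => f p.1 p.2) : PTime fun c => (l c).all (f c) := by
  have h := PTime.foldl_add (step := fun (c : γ) (b : Bool) (a : α) => b && f c a) hl (.const true)
    (.and PTime.fst.snd' (hf.comp (f := fun p : (γ × Bool) × α => (p.1.1, p.2))
      (PTime.fst.fst'.pair .snd))) (B := fun _ => 3) (.const 3)
    fun c b a ha => (sz_bool_le _).trans (by omega)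
  have e : ∀ (c : γ) (l : List α) (b : Bool),
      l.foldl (fun (b : Bool) (a : α) => b && f c a) b = (b && l.all (f c)) := by
    intro c l
    induction l with
    | nil => simp
    | cons a l ih => intro b; simp [ih, Bool.and_assoc]
  simpa [e] using h

theorem PTime.filter {l : γ → List α} {f : γ → α → Bool} (hl : PTime l)
    (hf : PTime fun p : γ × α => f p.1 p.2) : PTime fun c => (l c).filter (f c) := by
  have h := PTime.flatMap (f := fun c a => bif f c a then [a] else []) hl
    (.cond hf (.cons .snd (.const [])) (.const []))
  have e : ∀ (c : γ) (l : List α),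
      l.flatMap (fun a => bif f c a then [a] else []) = l.filter (f c) := by
    intro c l
    induction l with
    | nil => simp
    | cons a l ih => cases hc : f c a <;> simp_all
  simpa [e] using h

end

/-! ### Binary numbers and vectors over the field with two elements -/

/-- Pair up two lists of bits, filling up the shorter one with zeros. -/
def zipBits : List Bool → List Bool → List (Bool × Bool)
  | [], b => b.map fun y => (false, y)
  | x :: a, b => (x, b.headD false) :: zipBits a b.tail

/-- Bitwise sum modulo two. -/
def xorBits (a b : List Bool) : List Bool := (zipBits a b).map fun p => p.1 ^^ p.2

/-- Addition of pairs of binary digits with a carry. -/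
def addCarry : Bool → List (Bool × Bool) → List Bool
  | c, [] => bif c then [true] else []
  | c, p :: l => (c ^^ (p.1 ^^ p.2)) :: addCarry ((p.1 && p.2) || (c && (p.1 || p.2))) l

/-- Addition of binary numbers, least significant digit first. -/
def addBits (a b : List Bool) : List Bool := addCarry false (zipBits a b)

/-- Multiplication of binary numbers. -/
def mulBits (a b : List Bool) : List Bool :=
  a.foldr (fun x m => bif x then addBits b (false :: m) else false :: m) []

theorem length_zipBits (a b : List Bool) : (zipBits a b).length = max a.length b.length := by
  induction a generalizing b with
  | nil => simp [zipBits]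
  | cons x a ih => simp [zipBits, ih]; omega

theorem length_xorBits (a b : List Bool) : (xorBits a b).length = max a.length b.length := by
  simp [xorBits, length_zipBits]

theorem length_addCarry (c : Bool) (l : List (Bool × Bool)) :
    (addCarry c l).length ≤ l.length + 1 := by
  induction l generalizing c with
  | nil => cases c <;> simp [addCarry]
  | cons p l ih => simp [addCarry, ih]

theorem length_addBits (a b : List Bool) : (addBits a b).length ≤ max a.length b.length + 1 := by
  rw [← length_zipBits]; exact length_addCarry _ _

/-- Each digit of `a` costs one place for the shift and one for a carry. The coefficient 1 of the
length of `b` matters: a product accumulated in the second factor grows only additively. -/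
theorem length_mulBits (a b : List Bool) :
    (mulBits a b).length ≤ b.length + 2 * a.length := by
  induction a with
  | nil => simp [mulBits]
  | cons x a ih =>
    change (bif x then addBits b (false :: mulBits a b) else false :: mulBits a b).length ≤ _
    cases x
    · simp; omega
    · refine (length_addBits _ _).trans ?_
      simp; omega

section
variable {γ : Type} [Data γ]

theorem PTime.zipBits {a b : γ → List Bool} (ha : PTime a) (hb : PTime b) :
    PTime fun c => zipBits (a c) (b c) := by
  have h := PTime.foldl_add (l := a) (i := fun c => (b c, ([] : List (Bool × Bool))))
    (step := fun _ s x => (s.1.tail, (x, s.1.headD false) :: s.2)) ha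
    (hb.pair (.const [])) (.pair PTime.fst.snd'.fst'.tail
      (.cons (.pair .snd (.headD PTime.fst.snd'.fst' _)) PTime.fst.snd'.snd'))
    -- A pair of bits has size at most 3 + 3 + 1, and the list cell adds one.
    (B := fun _ => 8) (.const 8) fun c s x _ => by
      have h1 := sz_tail_le s.1
      have h2 := sz_bool_le x
      have h3 := sz_bool_le (s.1.headD false)
      simp only [sz_pair, sz_cons]
      omega
  -- The fold consumes `b` in parallel with `a`; what is left of `b` at the end is paired with
  -- zeros.
  have e : ∀ (a b : List Bool) (r : List (Bool × Bool)),
      (a.foldl (fun s x => (s.1.tail, (x, s.1.headD false) :: s.2)) (b, r)).2.reverse ++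
        (a.foldl (fun s x => (s.1.tail, (x, s.1.headD false) :: s.2)) (b, r)).1.map
          (fun y => (false, y)) = r.reverse ++ PolyTime.zipBits a b := by
    intro a
    induction a with
    | nil => intro b r; simp [PolyTime.zipBits]
    | cons x a ih =>
      intro b r
      rw [List.foldl_cons, ih, PolyTime.zipBits, List.reverse_cons, List.append_assoc]
      rfl
  have := h.snd'.reverse.append
    (h.fst'.map (f := fun _ y => (false, y)) (.pair (.const _) .snd))
  simpa only [e, List.reverse_nil, List.nil_append] using this

theorem PTime.xorBits {a b : γ → List Bool} (ha : PTime a) (hb : PTime b) :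
    PTime fun c => xorBits (a c) (b c) := by
  have h : PTime fun p : γ × (Bool × Bool) => p.2.1 ^^ p.2.2 := .xor PTime.snd.fst' PTime.snd.snd'
  exact (ha.zipBits hb).map (f := fun _ p => p.1 ^^ p.2) h

theorem PTime.addBits {a b : γ → List Bool} (ha : PTime a) (hb : PTime b) :
    PTime fun c => addBits (a c) (b c) := by
  have h := PTime.foldl_add (l := fun c => PolyTime.zipBits (a c) (b c))
    (i := fun _ => (false, ([] : List Bool)))
    (step := fun _ s p => ((p.1 && p.2) || (s.1 && (p.1 || p.2)), (s.1 ^^ (p.1 ^^ p.2)) :: s.2))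
    (ha.zipBits hb) (.const _)
    (.pair (.or (.and PTime.snd.fst' PTime.snd.snd')
        (.and PTime.fst.snd'.fst' (.or PTime.snd.fst' PTime.snd.snd')))
      (.cons (.xor PTime.fst.snd'.fst' (.xor PTime.snd.fst' PTime.snd.snd')) PTime.fst.snd'.snd'))
    (B := fun _ => 8) (.const 8) fun c s p _ => by
      have h1 := sz_bool_le ((p.1 && p.2) || (s.1 && (p.1 || p.2)))
      have h2 := sz_bool_le (s.1 ^^ (p.1 ^^ p.2))
      simp only [sz_pair, sz_cons]
      omega
  have e : ∀ (l : List (Bool × Bool)) (s : Bool × List Bool),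
      (bif (l.foldl (fun s p => ((p.1 && p.2) || (s.1 && (p.1 || p.2)),
          (s.1 ^^ (p.1 ^^ p.2)) :: s.2)) s).1 then
        true :: (l.foldl (fun s p => ((p.1 && p.2) || (s.1 && (p.1 || p.2)),
          (s.1 ^^ (p.1 ^^ p.2)) :: s.2)) s).2
      else (l.foldl (fun s p => ((p.1 && p.2) || (s.1 && (p.1 || p.2)),
          (s.1 ^^ (p.1 ^^ p.2)) :: s.2)) s).2).reverse = s.2.reverse ++ addCarry s.1 l := by
    intro l
    induction l with
    | nil => rintro ⟨c, r⟩; cases c <;> simp [addCarry]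
    | cons p l ih => rintro ⟨c, r⟩; simp only [List.foldl_cons, ih, addCarry]; simp
  have := (PTime.cond h.fst' (.cons (.const true) h.snd') h.snd').reverse
  simpa only [e, List.reverse_nil, List.nil_append, PolyTime.addBits] using this

theorem PTime.mulBits {a b : γ → List Bool} (ha : PTime a) (hb : PTime b) :
    PTime fun c => mulBits (a c) (b c) := by
  have h := PTime.foldl_inv (l := fun c => (a c).reverse) (i := fun _ => ([] : List Bool))
    (step := fun c m x => bif x then PolyTime.addBits (b c) (false :: m) else false :: m)
    ha.reverse (.const _)
    (.cond .snd (.addBits (hb.comp PTime.fst.fst') (.cons (.const _) PTime.fst.snd'))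
      (.cons (.const _) PTime.fst.snd'))
    (B := fun c => 4 * (sz (b c) + 2 * sz (a c)) + 1)
    (((PBdd.const 4).mul (hb.bdd.add ((PBdd.const 2).mul ha.bdd))).add (.const 1))
    (fun c n m => m.length ≤ (b c).length + 2 * n) (fun c => by simp)
    (fun c n m x _ hm => by
      cases x
      · simp; omega
      · refine (length_addBits _ _).trans ?_
        simp; omega)
    (fun c n m hn hm => by
      have h1 := length_le_sz (a c)
      have h2 := length_le_sz (b c)
      have h3 := sz_bits_le m
      rw [List.length_reverse] at hn
      omega)
  simpa [PolyTime.mulBits, List.foldl_reverse] using h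

end

/-! ### Correctness of the binary arithmetic -/

/-- The value of a binary number, least significant digit first. -/
def val : List Bool → ℕ
  | [] => 0
  | x :: a => x.toNat + 2 * val a

theorem val_addCarry (c : Bool) (l : List (Bool × Bool)) :
    val (addCarry c l) = c.toNat + val (l.map Prod.fst) + val (l.map Prod.snd) := by
  induction l generalizing c with
  | nil => cases c <;> simp [addCarry, val]
  | cons p l ih =>
    obtain ⟨x, y⟩ := p
    simp only [addCarry, val, ih, List.map_cons]
    cases c <;> cases x <;> cases y <;> simp <;> omega

theorem val_zipBits (a b : List Bool) :
    val ((zipBits a b).map Prod.fst) = val a ∧ val ((zipBits a b).map Prod.snd) = val b := by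
  induction a generalizing b with
  | nil =>
    constructor
    · induction b with
      | nil => simp [zipBits]
      | cons y b ih => simp_all [zipBits, val]
    · simp [zipBits, Function.comp_def]
  | cons x a ih =>
    cases b with
    | nil => simp [zipBits, val, ih]
    | cons y b => simp [zipBits, val, ih]

theorem val_addBits (a b : List Bool) : val (addBits a b) = val a + val b := by
  simp [addBits, val_addCarry, val_zipBits]

theorem val_mulBits (a b : List Bool) : val (mulBits a b) = val a * val b := by
  induction a with
  | nil => simp [mulBits, val]
  | cons x a ih =>
    change val (bif x then addBits b (false :: mulBits a b) else false :: mulBits a b) = _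
    cases x
    · simp [val, ih, mul_assoc]
    · simp [val, val_addBits, ih]; ring

theorem val_bits (n : ℕ) : val n.bits = n := by
  induction n using Nat.binaryRec' with
  | zero => simp [val]
  | bit b n h ih => rw [Nat.bits_append_bit _ _ h, val, ih, Nat.bit_val]; omega

/-- Computed numbers may have superfluous zeros at the most significant end. Padding the shorter one
makes the bitwise comparison insensitive to them. -/
theorem val_eq_iff (a b : List Bool) : val a = val b ↔ (xorBits a b).all (fun x => !x) = true := by
  induction a generalizing b with
  | nil =>
    induction b with
    | nil => simp [xorBits, zipBits]
    | cons y b ih =>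
      simp only [xorBits, zipBits, val, List.map_cons, List.map_map, List.all_cons,
        Bool.and_eq_true] at ih ⊢
      rw [← ih]
      cases y <;> simp <;> omega
  | cons x a ih =>
    have := ih b.tail
    simp only [xorBits] at this
    cases b with
    | nil => cases x <;> simp_all [xorBits, zipBits, val]
    | cons y b =>
      simp only [xorBits, zipBits, val, List.map_cons, List.all_cons, Bool.and_eq_true,
        List.headD_cons, List.tail_cons] at this ⊢
      rw [← this]
      cases x <;> cases y <;> simp <;> omega

/-! ### Letters as data -/

/-- The position of a letter in the alphabet, in unary. -/
def letterCode (a : Letter) : List Unit :=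
  List.replicate (match a with
    | .tick => 0
    | .bit b => bif b then 1 else 2
    | .var => 3
    | .con => 4
    | .tup => 5
    | .term => 6
    | .slash => 7
    | .sep => 8) ()

theorem letterCode_length_inj {a b : Letter} :
    (letterCode a).length = (letterCode b).length ↔ a = b := by
  rcases a with _ | (_ | _) | _ | _ | _ | _ | _ | _ <;>
    rcases b with _ | (_ | _) | _ | _ | _ | _ | _ | _ <;> simp [letterCode]

instance : Data Letter := ⟨fun a => Data.tree (letterCode a)⟩

section
variable {α β γ : Type} [Data α] [Data β] [Data γ]

theorem PTime.lengthEq {l : γ → List α} (hl : PTime l) (k : ℕ) :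
    PTime fun c => decide ((l c).length = k) := by
  induction k generalizing l with
  | zero =>
    refine cast (congrArg PTime ?_) hl.isEmpty
    funext c
    cases l c <;> simp
  | succ k ih =>
    refine cast (congrArg PTime ?_) (PTime.and hl.isEmpty.not (ih hl.tail))
    funext c
    rw [Bool.eq_iff_iff]
    rcases l c with _ | ⟨x, t⟩
    · simp
    · simp only [List.isEmpty_cons, Bool.not_false, List.tail_cons, Bool.true_and,
        decide_eq_true_eq, List.length_cons, Nat.add_right_cancel_iff]
      exact decide_eq_true_iff

theorem PTime.letterEq {a : γ → Letter} (ha : PTime a) (b : Letter) :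
    PTime fun c => decide (a c = b) := by
  have h : PTime letterCode := .of_same_word fun _ => rfl
  refine cast (congrArg PTime ?_) ((h.comp ha).lengthEq (letterCode b).length)
  funext c
  simp only [letterCode_length_inj]

/-- Case distinction on a letter. -/
theorem PTime.letterCases {a : γ → Letter} (ha : PTime a) {f : Letter → γ → β}
    (hf : ∀ a, PTime (f a)) : PTime fun c => f (a c) c := by
  have h : PTime fun c => if a c = .tick then f .tick c else if a c = .bit false then
      f (.bit false) c else if a c = .bit true then f (.bit true) c else if a c = .var then
      f .var c else if a c = .con then f .con c else if a c = .tup then f .tup c else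
      if a c = .term then f .term c else if a c = .slash then f .slash c else f .sep c :=
    .ite (ha.letterEq _) (hf _) <| .ite (ha.letterEq _) (hf _) <| .ite (ha.letterEq _) (hf _) <|
    .ite (ha.letterEq _) (hf _) <| .ite (ha.letterEq _) (hf _) <| .ite (ha.letterEq _) (hf _) <|
    .ite (ha.letterEq _) (hf _) <| .ite (ha.letterEq _) (hf _) (hf _)
  refine cast (congrArg PTime ?_) h
  funext c
  rcases a c with _ | (_ | _) | _ | _ | _ | _ | _ | _ <;> simp

end

/-! ### Input and output -/

/-- The longest code has eight units, each of size two in the list, and one end marker. -/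
theorem sz_letter_le (a : Letter) : sz a ≤ 17 := by
  rcases a with _ | (_ | _) | _ | _ | _ | _ | _ | _ <;> decide

/-- Move the input word to the work stack, as the representation of the reversed list. -/
def readInput : Frag :=
  seq (push .main false) (loop .inp fun a => seq (pushWord (word a)) (push .main true))

theorem runs_readInput_loop (w l : List Letter) :
    Runs (loop .inp fun a => seq (pushWord (word a)) (push .main true))
      (mem w [] (word l) [] [] []) (19 * w.length + 1) (work (word (w.reverse ++ l))) := by
  induction w generalizing l with
  | nil => exact runs_loop_nil rfl
  | cons a w ih =>
    have h := ih (a :: l)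
    refine (runs_loop_cons (s := w) rfl (n := sz a + 1) ?_ (m' := mem w [] (word (a :: l)) [] [] [])
      (by simpa using h)).mono ?_
    · simp only [update_inp]
      exact runs_seq (runs_pushWord _) (runs_push_main true)
    · have := sz_letter_le a
      simp only [List.length_cons]
      omega

theorem runs_readInput (w : List Letter) :
    Runs readInput (mem w [] [] [] [] []) (19 * w.length + 2) (work (word w.reverse)) := by
  have h := runs_readInput_loop w []
  rw [List.append_nil] at h
  exact (runs_seq (runs_push_main false) h).mono (by omega)

/-- Move a Boolean from the work stack to the output. -/
def writeOutput : Frag :=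
  pop .main fun
    | some true => pop .main fun _ => pop .main fun _ => push .out true
    | _ => push .out false

theorem runs_writeOutput (b : Bool) :
    Runs writeOutput (work (word b)) 4 (mem [] [b] [] [] [] []) := by
  cases b
  · exact (runs_pop_main (runs_push_out false)).mono (by omega)
  · exact (runs_pop_main (runs_pop_main (runs_pop_main (runs_push_out true)))).mono (by omega)

/-- A decision problem is solvable in polynomial time if a function computable in polynomial time
decides it on the reversed input words. -/
theorem PTime.solvable {α : Type} {enc : α → List Letter} {P : α → Prop} {f : List Letter → Bool}
    (hf : PTime f) (h : ∀ a, f (enc a).reverse = true ↔ P a) : SolvableInPolyTime enc P := by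
  obtain ⟨⟨F, t, ⟨p, hp⟩, hF⟩, -⟩ := hf
  refine solvable_of_frag enc P (seq readInput (seq F writeOutput))
    -- Reading costs 19 steps per letter: at most 17 pushes for its word, one for the list marker,
    -- one pop. The list read has size at most 18 per letter plus one, and writing the output takes
    -- at most 4 steps.
    (19 * .X + 2 + (p.comp (.X * 18 + 1) + 4)) (fun a => f (enc a).reverse) h fun a => ?_
  have h1 := hF (enc a).reverse []
  rw [List.append_nil, List.append_nil] at h1
  refine (runs_seq (runs_readInput _) (runs_seq h1 (runs_writeOutput _))).mono ?_
  have h2 := sz_le_of_forall (l := (enc a).reverse) fun a _ => sz_letter_le a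
  rw [List.length_reverse] at h2
  have h3 := (hp (enc a).reverse).trans (eval_mono p h2)
  simpa using h3

/-! ### Elimination over the field with two elements -/

/-- An affine equation over the field with two elements: the constant and the coefficients, the
missing ones being zero. -/
abbrev Row : Type := Bool × List Bool

/-- The coefficient of the first variable. -/
def rowHead (r : Row) : Bool := r.2.headD false

/-- Eliminate the first variable from `r` by means of the row `p`. -/
def reduceRow (p r : Row) : Row :=
  bif rowHead r then (r.1 ^^ p.1, (xorBits r.2 p.2).tail) else (r.1, r.2.tail)

/-- Eliminate the first variable. -/
def elim (rows : List Row) : List Row :=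
  rows.map (reduceRow ((rows.filter rowHead).headD (false, [])))

/-- Eliminate as many variables as the list has elements. -/
def elimMany {α : Type} (t : List α) (rows : List Row) : List Row :=
  t.foldl (fun rows _ => elim rows) rows

/-- The number of solutions, in binary, of a system in as many variables as the list has elements:
one eliminates all variables and doubles the number for each free one. -/
def countSol (t : List Bool) (rows : List Row) : List Bool :=
  let s := t.foldl (fun (s : List Row × List Bool) _ =>
    (elim s.1, bif (s.1.filter rowHead).isEmpty then false :: s.2 else s.2)) (rows, [true])
  bif s.1.all (fun r => !r.1) then s.2 else []

/-- The bound `M` on the lengths of the rows of a system with `k` rows. -/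
def RowsBdd (k M : ℕ) (rows : List Row) : Prop := rows.length = k ∧ ∀ r ∈ rows, r.2.length ≤ M

/-- Rows are transformed one by one, the pivot becoming the zero equation, so their number is
unchanged; the sum of two rows is no longer than the longer one. Hence iterated elimination needs no
growing bound. -/
theorem RowsBdd.elim {k M : ℕ} {rows : List Row} (h : RowsBdd k M rows) :
    RowsBdd k M (elim rows) := by
  refine ⟨by simp [PolyTime.elim, h.1], fun r' hr' => ?_⟩
  obtain ⟨r, hr, rfl⟩ := List.mem_map.1 hr'
  have hp : ((rows.filter rowHead).headD (false, [])).2.length ≤ M := by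
    cases hf : rows.filter rowHead with
    | nil => simp
    | cons p l =>
      have : p ∈ rows.filter rowHead := by rw [hf]; exact List.mem_cons_self
      exact h.2 p (List.mem_of_mem_filter this)
  have := h.2 r hr
  unfold reduceRow
  cases rowHead r
  · simp only [cond_false, List.length_tail]; omega
  · simp only [cond_true, List.length_tail, length_xorBits]; omega

theorem RowsBdd.sz_le {k M : ℕ} {rows : List Row} (h : RowsBdd k M rows) :
    sz rows ≤ k * (4 * M + 6) + 1 := by
  rw [← h.1]
  refine sz_le_of_forall fun r hr => ?_
  have h1 := sz_bool_le r.1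
  have h2 := sz_bits_le r.2
  have h3 := h.2 r hr
  rw [sz_pair]; omega

theorem rowsBdd_sz (rows : List Row) : RowsBdd rows.length (sz rows) rows :=
  ⟨rfl, fun r hr => by
    have h1 := sz_lt_of_mem hr
    have h2 := length_le_sz r.2
    rw [sz_pair] at h1
    omega⟩

section
variable {α γ : Type} [Data α] [Data γ]

theorem PTime.rowHead {r : γ → Row} (hr : PTime r) : PTime fun c => rowHead (r c) :=
  hr.snd'.headD false

theorem PTime.elim {rows : γ → List Row} (hr : PTime rows) : PTime fun c => elim (rows c) := by
  have hp : PTime fun c => ((rows c).filter PolyTime.rowHead).headD (false, []) :=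
    (hr.filter (f := fun _ r => PolyTime.rowHead r) (.rowHead .snd)).headD _
  exact hr.map (f := fun c => reduceRow (((rows c).filter PolyTime.rowHead).headD (false, [])))
    (.cond (.rowHead .snd) (.pair (.xor PTime.snd.fst' (hp.comp .fst).fst')
      (.tail (.xorBits PTime.snd.snd' (hp.comp .fst).snd'))) (.pair PTime.snd.fst'
        (.tail PTime.snd.snd')))

theorem PBdd.rows {rows : γ → List Row} (hr : PTime rows) :
    PBdd fun c => sz (rows c) * (4 * sz (rows c) + 6) + 1 :=
  (hr.bdd.mul (((PBdd.const 4).mul hr.bdd).add (.const 6))).add (.const 1)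

theorem PTime.elimMany {t : γ → List α} {rows : γ → List Row} (ht : PTime t) (hr : PTime rows) :
    PTime fun c => elimMany (t c) (rows c) :=
  .foldl_inv ht hr (step := fun _ b _ => PolyTime.elim b) (.elim PTime.fst.snd') (PBdd.rows hr)
    (fun c _ b => RowsBdd (rows c).length (sz (rows c)) b) (fun _ => rowsBdd_sz _)
    (fun _ _ _ _ _ h => h.elim) fun _ _ _ _ h =>
      h.sz_le.trans (Nat.add_le_add_right (Nat.mul_le_mul_right _ (length_le_sz _)) _)

theorem PTime.countSol {t : γ → List Bool} {rows : γ → List Row} (ht : PTime t)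
    (hr : PTime rows) : PTime fun c => countSol (t c) (rows c) := by
  have h := PTime.foldl_inv (l := t) (i := fun c => (rows c, [true]))
    (step := fun _ (s : List Row × List Bool) _ =>
      (PolyTime.elim s.1, bif (s.1.filter PolyTime.rowHead).isEmpty then false :: s.2 else s.2))
    ht (hr.pair (.const _)) (.pair (.elim PTime.fst.snd'.fst')
      (.cond (PTime.filter (f := fun _ r => PolyTime.rowHead r) PTime.fst.snd'.fst'
        (.rowHead .snd)).isEmpty (.cons (.const _) PTime.fst.snd'.snd') PTime.fst.snd'.snd'))
    (B := fun c => (sz (rows c) * (4 * sz (rows c) + 6) + 1) + (4 * (sz (t c) + 1) + 1) + 1)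
    (((PBdd.rows hr).add (((PBdd.const 4).mul (ht.bdd.add (.const 1))).add (.const 1))).add
      (.const 1))
    -- The count starts with one digit, and a doubling adds one more.
    (fun c n s => RowsBdd (rows c).length (sz (rows c)) s.1 ∧ s.2.length ≤ n + 1)
    (fun c => ⟨rowsBdd_sz _, by simp⟩)
    (fun c n s a _ hs => ⟨hs.1.elim, by
      have := hs.2
      dsimp only
      cases (s.1.filter PolyTime.rowHead).isEmpty
      · simp only [cond_false]; omega
      · simp only [cond_true, List.length_cons]; omega⟩)
    (fun c n s hn hs => by
      have h1 := hs.1.sz_le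
      have h2 := sz_bits_le s.2
      have h3 := length_le_sz (t c)
      have h4 : (rows c).length * (4 * sz (rows c) + 6) ≤ sz (rows c) * (4 * sz (rows c) + 6) :=
        Nat.mul_le_mul_right _ (length_le_sz _)
      have h5 := hs.2
      rw [sz_pair]
      omega)
  exact .cond (.all (f := fun _ r => !r.1) h.fst' (.not PTime.snd.fst')) h.snd' (.const _)

end

/-! ### The equations of a constraint -/

/-- The equation that sets a variable, given by its index in unary, to one. -/
def varRow (i : List Bool) : Row := (true, i ++ [true])

/-- The equations, one for each position of the scope, that express the variables in terms of the
coefficients of a linear combination of the tuples. -/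
def positionRows : List (List Bool) → List (List Bool) → List Row
  | [], _ => []
  | i :: scope, tuples =>
    (false, tuples.map (fun t => t.headD false) ++ (i ++ [true])) ::
      positionRows scope (tuples.map List.tail)

/-- A constraint, given by its scope and its tuples. -/
abbrev ConData : Type := List (List Bool) × List (List Bool)

/-- The equations for the variables of a constraint: they form a linear combination of the tuples
with an odd number of terms. -/
def constraintRows (C : ConData) : List Row :=
  elimMany C.2 ((true, C.2.map fun _ => true) :: positionRows C.1 C.2)

section
variable {γ : Type} [Data γ]

theorem PTime.varRow {i : γ → List Bool} (hi : PTime i) : PTime fun c => varRow (i c) :=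
  .pair (.const _) (hi.append (.const _))

theorem PTime.positionRows {s t : γ → List (List Bool)} (hs : PTime s) (ht : PTime t) :
    PTime fun c => positionRows (s c) (t c) := by
  have h := PTime.foldl_inv (l := s) (i := fun c => (t c, ([] : List Row)))
    (step := fun _ (b : List (List Bool) × List Row) i => (b.1.map List.tail,
      (false, b.1.map (fun t => t.headD false) ++ (i ++ [true])) :: b.2))
    hs (ht.pair (.const _))
    (.pair (.map (f := fun _ (t : List Bool) => t.tail) PTime.fst.snd'.fst' PTime.snd.tail)
      (.cons (.pair (.const _) (.append (.map (f := fun _ (t : List Bool) => t.headD false) PTime.fst.snd'.fst'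
        (.headD .snd _)) (.append .snd (.const _)))) PTime.fst.snd'.snd'))
    (B := fun c => sz (t c) + 1 + sz (s c) * (4 * (sz (t c) + sz (s c) + 1) + 3) + 1)
    (((ht.bdd.add (.const 1)).add (hs.bdd.mul (((PBdd.const 4).mul
      ((ht.bdd.add hs.bdd).add (.const 1))).add (.const 3)))).add (.const 1))
    -- The tuples only shrink, and each position contributes one row: a digit per tuple followed by
    -- a unary index.
    (fun c n b => sz b.1 ≤ sz (t c) ∧
      sz b.2 ≤ 1 + n * (4 * (sz (t c) + sz (s c) + 1) + 3))
    (fun c => ⟨le_rfl, by simp⟩)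
    (fun c n b i hi hb => by
      have h1 : sz (b.1.map List.tail) ≤ sz b.1 := by
        induction b.1 with
        | nil => simp
        | cons x l ih =>
          have := sz_tail_le x
          rw [List.map_cons, sz_cons, sz_cons]; omega
      have h2 := sz_bits_le (b.1.map (fun t => t.headD false) ++ (i ++ [true]))
      have h3 := length_le_sz b.1
      have h4 := sz_lt_of_mem hi
      have h5 := length_le_sz i
      have h6 : sz false = 1 := rfl
      simp only [List.length_append, List.length_map, List.length_singleton] at h2
      refine ⟨h1.trans hb.1, ?_⟩
      have := hb.1
      have := hb.2
      rw [sz_cons, sz_pair, Nat.succ_mul]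
      dsimp only
      omega)
    (fun c n b hn hb => by
      have h1 := length_le_sz (s c)
      have h2 : n * (4 * (sz (t c) + sz (s c) + 1) + 3) ≤
        sz (s c) * (4 * (sz (t c) + sz (s c) + 1) + 3) := Nat.mul_le_mul_right _ (hn.trans h1)
      have := hb.1
      have := hb.2
      rw [sz_pair]
      omega)
  have e : ∀ (s t : List (List Bool)) (r : List Row),
      (s.foldl (fun (b : List (List Bool) × List Row) i => (b.1.map List.tail,
        (false, b.1.map (fun t => t.headD false) ++ (i ++ [true])) :: b.2)) (t, r)).2.reverse =
      r.reverse ++ PolyTime.positionRows s t := by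
    intro s
    induction s with
    | nil => intro t r; simp [PolyTime.positionRows]
    | cons i s ih =>
      intro t r
      rw [List.foldl_cons, ih, PolyTime.positionRows, List.reverse_cons, List.append_assoc]
      rfl
  have := h.snd'.reverse
  simpa only [e, List.reverse_nil, List.nil_append] using this

theorem PTime.constraintRows {C : γ → ConData} (hC : PTime C) :
    PTime fun c => constraintRows (C c) :=
  .elimMany hC.snd' (.cons (.pair (.const _) (.map (f := fun _ _ => true) hC.snd' (.const _)))
    (.positionRows hC.fst' hC.snd'))

end

/-! ### The decision procedure on parsed inputs -/

/-- A term: the sign and the numerator of the coefficient, its denominator, and the variables. -/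
abbrev TermData : Type := (Bool × List Bool) × (List Bool × List (List Bool))

/-- The number of solutions, in binary, at which the monomials of `s` and `t` do not vanish. -/
def commonCount (n : List Bool) (sys : List Row) (s t : TermData) : List Bool :=
  countSol n (sys ++ (s.2.2 ++ t.2.2).map varRow)

/-- Add a coefficient times a natural number to a fraction; fractions are given by the positive
and the negative part of the numerator, and the denominator. -/
def addFraction (t : TermData) (k : List Bool) (a : List Bool × List Bool × List Bool) :
    List Bool × List Bool × List Bool :=
  (addBits (mulBits t.2.1 a.1) (bif t.1.1 then [] else mulBits (mulBits t.1.2 k) a.2.2),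
    addBits (mulBits t.2.1 a.2.1) (bif t.1.1 then mulBits (mulBits t.1.2 k) a.2.2 else []),
    mulBits t.2.1 a.2.2)

/-- The sum over the solutions of the product of the polynomial with the monomial of `s`. -/
def inner (n : List Bool) (sys : List Row) (ts : List TermData) (s : TermData) :
    List Bool × List Bool × List Bool :=
  ts.foldl (fun a t => addFraction t (commonCount n sys s t) a) ([], [], [true])

/-- Is the polynomial orthogonal, on the set of solutions, to all its monomials? -/
def decideParsed (n : List Bool) (cs : List ConData) (ts : List TermData) : Bool :=
  ts.all fun s => (xorBits (inner n (cs.flatMap constraintRows) ts s).1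
    (inner n (cs.flatMap constraintRows) ts s).2.1).all fun x => !x

/-- In every product the accumulated number is the second factor, so `length_mulBits` gives an
additive increase depending on the term and the count alone. The fractions can therefore be left
unreduced over the product of all denominators. -/
theorem length_addFraction (t : TermData) (k : List Bool) (a : List Bool × List Bool × List Bool)
    {m : ℕ} (h1 : a.1.length ≤ m) (h2 : a.2.1.length ≤ m) (h3 : a.2.2.length ≤ m) :
    (addFraction t k a).1.length ≤ m + (8 * sz t + 2 * sz k + 1) ∧
    (addFraction t k a).2.1.length ≤ m + (8 * sz t + 2 * sz k + 1) ∧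
    (addFraction t k a).2.2.length ≤ m + (8 * sz t + 2 * sz k + 1) := by
  have e1 := length_mulBits t.2.1 a.1
  have e2 := length_mulBits t.2.1 a.2.1
  have e3 := length_mulBits t.2.1 a.2.2
  have e4 := length_mulBits t.1.2 k
  have e5 := length_mulBits (mulBits t.1.2 k) a.2.2
  have e6 := length_le_sz k
  have e7 := length_le_sz t.1.2
  have e8 := length_le_sz t.2.1
  have e9 : sz t.1.2 + sz t.2.1 ≤ sz t := by
    rw [sz_pair t, sz_pair t.1, sz_pair t.2]; omega
  unfold addFraction
  refine ⟨(length_addBits _ _).trans ?_, (length_addBits _ _).trans ?_, by dsimp only; omega⟩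
  · cases t.1.1
    · simp only [cond_false]; omega
    · simp only [cond_true, List.length_nil]; omega
  · cases t.1.1
    · simp only [cond_false, List.length_nil]; omega
    · simp only [cond_true]; omega

section
variable {γ : Type} [Data γ]

theorem PTime.commonCount {n : γ → List Bool} {sys : γ → List Row} {s t : γ → TermData}
    (hn : PTime n) (hsys : PTime sys) (hs : PTime s) (ht : PTime t) :
    PTime fun c => commonCount (n c) (sys c) (s c) (t c) :=
  .countSol hn (hsys.append (.map (f := fun _ i => PolyTime.varRow i)
    (hs.snd'.snd'.append ht.snd'.snd') (.varRow .snd)))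

theorem PTime.addFraction {t : γ → TermData} {k : γ → List Bool}
    {a : γ → List Bool × List Bool × List Bool} (ht : PTime t) (hk : PTime k) (ha : PTime a) :
    PTime fun c => addFraction (t c) (k c) (a c) := by
  have h : PTime fun c => PolyTime.mulBits (PolyTime.mulBits (t c).1.2 (k c)) (a c).2.2 :=
    .mulBits (.mulBits ht.fst'.snd' hk) ha.snd'.snd'
  exact .pair (.addBits (.mulBits ht.snd'.fst' ha.fst') (.cond ht.fst'.fst' (.const _) h))
    (.pair (.addBits (.mulBits ht.snd'.fst' ha.snd'.fst') (.cond ht.fst'.fst' h (.const _)))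
      (.mulBits ht.snd'.fst' ha.snd'.snd'))

theorem PTime.inner {n : γ → List Bool} {sys : γ → List Row} {ts : γ → List TermData}
    {s : γ → TermData} (hn : PTime n) (hsys : PTime sys) (hts : PTime ts) (hs : PTime s) :
    PTime fun c => inner (n c) (sys c) (ts c) (s c) := by
  obtain ⟨B, hB, hb⟩ := PTime.mapBdd (f := fun c t => PolyTime.commonCount (n c) (sys c) (s c) t)
    hts (.commonCount (hn.comp .fst) (hsys.comp .fst) (hs.comp .fst) .snd)
  refine PTime.foldl_inv hts (.const _)
    (step := fun c a t =>
      PolyTime.addFraction t (PolyTime.commonCount (n c) (sys c) (s c) t) a)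
    (.addFraction .snd (.commonCount (hn.comp PTime.fst.fst') (hsys.comp PTime.fst.fst')
      (hs.comp PTime.fst.fst') .snd) PTime.fst.snd')
    (B := fun c => 12 * (1 + sz (ts c) * (8 * sz (ts c) + 2 * B c + 1)) + 5)
    (((PBdd.const 12).mul ((PBdd.const 1).add (hts.bdd.mul ((((PBdd.const 8).mul hts.bdd).add
      ((PBdd.const 2).mul hB)).add (.const 1))))).add (.const 5))
    (fun c k a => a.1.length ≤ 1 + k * (8 * sz (ts c) + 2 * B c + 1) ∧
      a.2.1.length ≤ 1 + k * (8 * sz (ts c) + 2 * B c + 1) ∧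
      a.2.2.length ≤ 1 + k * (8 * sz (ts c) + 2 * B c + 1))
    (fun c => by simp) (fun c k a t ht ha => ?_) (fun c k a hk ha => ?_)
  · have h1 := sz_lt_of_mem ht
    have h2 := hb c t ht
    obtain ⟨h3, h4, h5⟩ := length_addFraction t (PolyTime.commonCount (n c) (sys c) (s c) t) a
      ha.1 ha.2.1 ha.2.2
    rw [Nat.succ_mul]
    refine ⟨?_, ?_, ?_⟩ <;> omega
  · have h1 : k * (8 * sz (ts c) + 2 * B c + 1) ≤ sz (ts c) * (8 * sz (ts c) + 2 * B c + 1) :=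
      Nat.mul_le_mul_right _ (hk.trans (length_le_sz _))
    have h2 := sz_bits_le a.1
    have h3 := sz_bits_le a.2.1
    have h4 := sz_bits_le a.2.2
    obtain ⟨h5, h6, h7⟩ := ha
    rw [sz_pair, sz_pair]
    omega

theorem PTime.decideParsed {n : γ → List Bool} {cs : γ → List ConData} {ts : γ → List TermData}
    (hn : PTime n) (hcs : PTime cs) (hts : PTime ts) :
    PTime fun c => decideParsed (n c) (cs c) (ts c) := by
  have hsys : PTime fun c => (cs c).flatMap PolyTime.constraintRows :=
    hcs.flatMap (f := fun _ C => PolyTime.constraintRows C) (.constraintRows .snd)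
  have hinner : PTime fun p : γ × TermData =>
      PolyTime.inner (n p.1) ((cs p.1).flatMap PolyTime.constraintRows) (ts p.1) p.2 :=
    .inner (hn.comp .fst) (hsys.comp .fst) (hts.comp .fst) .snd
  exact hts.all (f := fun c s =>
    (PolyTime.xorBits (PolyTime.inner (n c) ((cs c).flatMap PolyTime.constraintRows) (ts c) s).1
      (PolyTime.inner (n c) ((cs c).flatMap PolyTime.constraintRows) (ts c) s).2.1).all
        fun x => !x)
    (.all (f := fun _ x => !x) (.xorBits hinner.fst' hinner.snd'.fst') (.not .snd))

end

/-! ### Parsing -/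

/-- The state of the parser, which reads the input word from its end: the pending ticks, the
pending bits, variables, tuples and denominator, and the constraints and terms found so far. -/
abbrev ParseState : Type :=
  List Bool × List Bool × List (List Bool) × List (List Bool) × List Bool ×
    List ConData × List TermData

/-- The transition of the parser. -/
def parseStep : Letter → ParseState → ParseState
  | .tick, (t, b, v, u, d, c, p) => (false :: t, b, v, u, d, c, p)
  | .bit x, (t, b, v, u, d, c, p) => (t, x :: b, v, u, d, c, p)
  | .var, (t, b, v, u, d, c, p) => ([], b, t :: v, u, d, c, p)
  | .con, (t, b, v, u, d, c, p) => (t, b, [], [], d, (v, u) :: c, p)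
  | .tup, (t, b, v, u, d, c, p) => (t, [], v, b :: u, d, c, p)
  -- Reading from the end, the bits pending here are the sign followed by the numerator; the
  -- denominator was set aside at the slash.
  | .term, (t, b, v, u, d, c, p) => (t, [], [], u, [], c, ((b.headD false, b.tail), (d, v)) :: p)
  | .slash, (t, b, v, u, _, c, p) => (t, [], v, u, b, c, p)
  | .sep, s => s

/-- The initial state of the parser. -/
def parseInit : ParseState := ([], [], [], [], [], [], [])

/-- The parser. -/
def parse (w : List Letter) : ParseState := w.foldr parseStep parseInit

/-- The decision procedure on reversed input words. -/
def decideReversed (w : List Letter) : Bool :=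
  let s := parse w.reverse
  decideParsed s.1 s.2.2.2.2.2.1 s.2.2.2.2.2.2

theorem ptime_parseStep (a : Letter) : PTime (parseStep a) := by
  have t : PTime fun s : ParseState => s.1 := .fst
  have r1 : PTime fun s : ParseState => s.2 := .snd
  have b := r1.fst'
  have v := r1.snd'.fst'
  have u := r1.snd'.snd'.fst'
  have d := r1.snd'.snd'.snd'.fst'
  have c := r1.snd'.snd'.snd'.snd'.fst'
  have p := r1.snd'.snd'.snd'.snd'.snd'
  cases a with
  | tick => exact .pair (.cons (.const _) t) r1
  | bit x => exact .pair t (.pair (.cons (.const _) b) r1.snd')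
  | var => exact .pair (.const _) (.pair b (.pair (.cons t v) r1.snd'.snd'))
  | con => exact .pair t (.pair b (.pair (.const _) (.pair (.const _) (.pair d
      (.pair (.cons (v.pair u) c) p)))))
  | tup => exact .pair t (.pair (.const _) (.pair v (.pair (.cons b u) r1.snd'.snd'.snd')))
  | term => exact .pair t (.pair (.const _) (.pair (.const _) (.pair u (.pair (.const _) (.pair c
      (.cons (.pair (.pair (b.headD _) b.tail) (.pair d v)) p))))))
  | slash => exact .pair t (.pair (.const _) (.pair v (.pair u (.pair b r1.snd'.snd'.snd'.snd'))))
  | sep => exact .id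

/-- Pending data are moved or discarded, never copied, so a letter adds only a bounded amount. -/
theorem sz_parseStep_le (a : Letter) (s : ParseState) : sz (parseStep a s) ≤ sz s + 20 := by
  obtain ⟨t, b, v, u, d, c, p⟩ := s
  have hf : sz false = 1 := rfl
  cases a with
  | bit x =>
    have := sz_bool_le x
    simp only [parseStep, sz_pair, sz_cons]; omega
  | term =>
    have h1 := sz_bool_le (b.headD false)
    have h2 := sz_tail_le b
    simp only [parseStep, sz_pair, sz_cons, sz_nil]; omega
  | slash =>
    have := sz_pos d
    simp only [parseStep, sz_pair, sz_nil]; omega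
  | sep => exact Nat.le_add_right _ _
  | _ => simp only [parseStep, sz_pair, sz_cons, sz_nil]; omega

theorem ptime_decideReversed : PTime decideReversed := by
  have h := PTime.foldl_add (l := fun w : List Letter => w) (i := fun _ => parseInit)
    (step := fun _ s a => parseStep a s) .id (.const _)
    ((PTime.snd (α := List Letter × ParseState) (β := Letter)).letterCases
      (f := fun a p => parseStep a p.1.2) fun a => (ptime_parseStep a).comp PTime.fst.snd')
    (B := fun _ => 20) (.const _) fun _ s a _ => sz_parseStep_le a s
  have e : (fun w : List Letter => w.foldl (fun s a => parseStep a s) parseInit) =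
      fun w => parse w.reverse := by
    funext w; rw [parse, List.foldr_reverse]
  rw [e] at h
  exact .decideParsed h.fst' h.snd'.snd'.snd'.snd'.snd'.fst' h.snd'.snd'.snd'.snd'.snd'.snd'

/-! ### Correctness of the elimination -/

/-- The scalar product, missing entries being zero. -/
def dot : List Bool → List Bool → Bool
  | _, [] => false
  | l, b :: y => (l.headD false && b) ^^ dot l.tail y

/-- The value of an affine equation. -/
def rowVal (r : Row) (y : List Bool) : Bool := r.1 ^^ dot r.2 y

/-- `y` satisfies all equations. -/
def Sat (rows : List Row) (y : List Bool) : Prop := ∀ r ∈ rows, rowVal r y = false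

instance (rows : List Row) (y : List Bool) : Decidable (Sat rows y) :=
  inferInstanceAs (Decidable (∀ r ∈ rows, rowVal r y = false))

theorem dot_nil (y : List Bool) : dot [] y = false := by
  induction y with
  | nil => rfl
  | cons b y ih => simpa [dot] using ih

theorem dot_xorBits (a b y : List Bool) : dot (xorBits a b) y = (dot a y ^^ dot b y) := by
  induction y generalizing a b with
  | nil => rfl
  | cons c y ih =>
    have h : (xorBits a b).headD false = (a.headD false ^^ b.headD false) ∧
        (xorBits a b).tail = xorBits a.tail b.tail := by
      cases a <;> cases b <;> simp [xorBits, zipBits]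
    rw [dot, dot, dot, h.1, h.2, ih]
    cases a.headD false <;> cases b.headD false <;> cases c <;> simp [Bool.xor_comm]

theorem dot_append {l z : List Bool} (m y : List Bool) (h : l.length = z.length) :
    dot (l ++ m) (z ++ y) = (dot l z ^^ dot m y) := by
  induction z generalizing l with
  | nil =>
    rw [List.length_nil, List.length_eq_zero_iff] at h
    simp [h, dot]
  | cons b z ih =>
    cases l with
    | nil => simp at h
    | cons a l => simp [dot, ih (l := l) (by simpa using h)]

theorem dot_unit (i : ℕ) (y : List Bool) :
    dot (List.replicate i false ++ [true]) y = y.getD i false := by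
  induction i generalizing y with
  | zero => cases y <;> simp [dot, dot_nil]
  | succ i ih =>
    cases y with
    | nil => rfl
    | cons b y => simpa [dot, List.replicate_succ] using ih y

/-- Adding the pivot row amounts to substituting the value that it prescribes for the first
variable. Rows without this variable do not depend on `b`, so nothing is required for them. -/
theorem rowVal_reduceRow {p r : Row} {b : Bool} {y : List Bool}
    (h : rowHead r = true → b = (p.1 ^^ dot p.2.tail y)) :
    rowVal (reduceRow p r) y = rowVal r (b :: y) := by
  have e : (xorBits r.2 p.2).tail = xorBits r.2.tail p.2.tail := by
    cases r.2 <;> cases p.2 <;> simp [xorBits, zipBits]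
  unfold reduceRow rowVal
  cases hr : rowHead r
  · have : r.2.headD false = false := hr
    rw [dot, this]
    simp
  · have h2 : r.2.headD false = true := hr
    rw [dot, h2, h hr]
    simp only [cond_true, e, dot_xorBits, Bool.true_and]
    cases r.1 <;> cases p.1 <;> cases dot r.2.tail y <;> cases dot p.2.tail y <;> rfl

/-- No equation contains the first variable, so `b` is arbitrary. The default pivot in `elim` is
never added to a row here. -/
theorem sat_elim_of_free {rows : List Row} (h : (rows.filter rowHead).isEmpty = true) (b : Bool)
    (y : List Bool) : Sat rows (b :: y) ↔ Sat (elim rows) y := by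
  have h0 : ∀ r ∈ rows, ¬ rowHead r = true := by
    simpa [List.filter_eq_nil_iff] using h
  unfold Sat elim
  rw [List.forall_mem_map]
  refine forall₂_congr fun r hr => ?_
  rw [rowVal_reduceRow (b := b) fun hh => absurd hh (h0 r hr)]

/-- The pivot equation has leading coefficient one and determines the first variable from the
others; for that value the remaining equations agree with the eliminated ones. -/
theorem sat_elim_of_pivot {rows : List Row} (h : (rows.filter rowHead).isEmpty = false)
    (y : List Bool) : ∃ b₀, ∀ b, Sat rows (b :: y) ↔ b = b₀ ∧ Sat (elim rows) y := by
  obtain ⟨p, l, hp⟩ := List.exists_cons_of_ne_nil (l := rows.filter rowHead) (by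
    intro h'; simp [h'] at h)
  have hmem : p ∈ rows.filter rowHead := by rw [hp]; exact List.mem_cons_self
  have hpr : p ∈ rows := List.mem_of_mem_filter hmem
  have hph : p.2.headD false = true := (List.mem_filter.1 hmem).2
  have hpv : ∀ b, rowVal p (b :: y) = false ↔ b = (p.1 ^^ dot p.2.tail y) := by
    intro b
    rw [rowVal, dot, hph]
    cases p.1 <;> cases b <;> cases dot p.2.tail y <;> decide
  have hs : Sat (elim rows) y ↔ Sat rows ((p.1 ^^ dot p.2.tail y) :: y) := by
    unfold Sat elim
    rw [List.forall_mem_map, hp, List.headD_cons]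
    refine forall₂_congr fun r hr => ?_
    rw [rowVal_reduceRow fun _ => rfl]
  refine ⟨p.1 ^^ dot p.2.tail y, fun b => ⟨fun hb => ?_, ?_⟩⟩
  · have := (hpv b).1 (hb p hpr)
    exact ⟨this, hs.2 (this ▸ hb)⟩
  · rintro ⟨rfl, h'⟩
    exact hs.1 h'

/-- Elimination is projection along the first coordinate, that is, it removes an existential
quantifier. -/
theorem sat_elim (rows : List Row) (y : List Bool) :
    Sat (elim rows) y ↔ ∃ b, Sat rows (b :: y) := by
  cases h : (rows.filter rowHead).isEmpty
  · obtain ⟨b₀, hb⟩ := sat_elim_of_pivot h y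
    simp [hb]
  · simp [sat_elim_of_free h]

theorem sat_elimMany {α : Type} (t : List α) (rows : List Row) (y : List Bool) :
    Sat (elimMany t rows) y ↔ ∃ z : List Bool, z.length = t.length ∧ Sat rows (z ++ y) := by
  induction t generalizing rows with
  | nil => simp [elimMany]
  | cons a t ih =>
    have : elimMany (a :: t) rows = elimMany t (elim rows) := rfl
    rw [this, ih]
    constructor
    · rintro ⟨z, hz, h⟩
      obtain ⟨b, hb⟩ := (sat_elim _ _).1 h
      exact ⟨b :: z, by simp [hz], hb⟩
    · rintro ⟨z, hz, h⟩
      cases z with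
      | nil => simp at hz
      | cons b z => exact ⟨z, by simpa using hz, (sat_elim _ _).2 ⟨b, h⟩⟩

/-- The number of solutions of a system in `k` variables. -/
def numSol (k : ℕ) (rows : List Row) : ℕ :=
  ∑ x : Fin k → Bool, if Sat rows (List.ofFn x) then 1 else 0

theorem numSol_succ (k : ℕ) (rows : List Row) : numSol (k + 1) rows =
    ∑ x : Fin k → Bool, ∑ b : Bool, if Sat rows (b :: List.ofFn x) then 1 else 0 := by
  unfold numSol
  rw [← (Fin.consEquiv fun _ => Bool).sum_comp, Fintype.sum_prod_type_right]
  refine Finset.sum_congr rfl fun x _ => Finset.sum_congr rfl fun b _ => ?_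
  simp [Fin.consEquiv, List.ofFn_succ]

/-- Over each solution of the eliminated system the fibre of the projection has two points if the
first variable is free and one otherwise. -/
theorem numSol_elim (k : ℕ) (rows : List Row) : numSol (k + 1) rows =
    (if (rows.filter rowHead).isEmpty then 2 else 1) * numSol k (elim rows) := by
  rw [numSol_succ, numSol, Finset.mul_sum]
  refine Finset.sum_congr rfl fun x _ => ?_
  cases h : (rows.filter rowHead).isEmpty
  · obtain ⟨b₀, hb⟩ := sat_elim_of_pivot h (List.ofFn x)
    simp only [hb]
    by_cases h' : Sat (elim rows) (List.ofFn x) <;> simp [h']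
  · simp only [sat_elim_of_free h]
    simp

theorem val_countSol (t : List Bool) (rows : List Row) :
    val (countSol t rows) = numSol t.length rows := by
  have key : ∀ (t : List Bool) (s : List Row × List Bool),
      (let s' := t.foldl (fun (s : List Row × List Bool) _ => (elim s.1,
        bif (s.1.filter rowHead).isEmpty then false :: s.2 else s.2)) s
      val (bif s'.1.all (fun r => !r.1) then s'.2 else [])) = val s.2 * numSol t.length s.1 := by
    intro t
    induction t with
    | nil =>
      intro s
      -- Without variables an equation is just its constant, so the system is consistent iff all
      -- constants are zero.
      have h : numSol 0 s.1 = if s.1.all (fun r => !r.1) = true then 1 else 0 := by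
        simp only [numSol, List.ofFn_zero, Finset.sum_const, Finset.card_univ,
          Fintype.card_unique, one_smul]
        exact if_congr (by simp [Sat, rowVal, dot]) rfl rfl
      simp only [List.foldl_nil, List.length_nil, h]
      cases s.1.all (fun r => !r.1) <;> simp [val]
    | cons a t ih =>
      intro s
      rw [List.length_cons, numSol_elim, List.foldl_cons, ih]
      cases (s.1.filter rowHead).isEmpty <;> simp [val]
      ring
  have := key t (rows, [true])
  simpa [val, countSol] using this

/-! ### Correctness of the equations of a constraint -/

/-- One coefficient vector must select `t` for all functions `f` at once: it is used for every
coordinate of a tuple and for the parity of the number of terms. -/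
theorem exists_unitVector {α : Type} {T : List α} {t : α} (ht : t ∈ T) :
    ∃ z : List Bool, z.length = T.length ∧ ∀ f : α → Bool, dot (T.map f) z = f t := by
  induction T with
  | nil => cases ht
  | cons a T ih =>
    have h0 : ∀ (n : ℕ) (l : List Bool), dot l (List.replicate n false) = false := by
      intro n
      induction n with
      | zero => intro l; rfl
      | succ n ih => intro l; simp [List.replicate_succ, dot, ih]
    rcases List.mem_cons.1 ht with rfl | ht
    · exact ⟨true :: List.replicate T.length false, by simp, fun f => by simp [dot, h0]⟩
    · obtain ⟨z, hz, h⟩ := ih ht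
      exact ⟨false :: z, by simp [hz], fun f => by simp [dot, h]⟩

/-- Among three Boolean values two coincide, so the minority identities determine the operation. -/
theorem minority_eq_xor {g : (Fin 3 → Bool) → Bool} (hg : IsMinority g) (a b c : Bool) :
    g ![a, b, c] = (a ^^ (b ^^ c)) := by
  cases a <;> cases b <;> cases c
  · exact (hg false false).1
  · exact (hg false true).1
  · exact (hg false true).2.1
  · exact (hg true false).2.2
  · exact (hg false true).2.2
  · exact (hg true false).2.1
  · exact (hg true false).1
  · exact (hg true true).1

/-- A relation closed under the minority operation contains all linear combinations of its tuples
with an odd number of terms. -/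
theorem combination_mem {g : (Fin 3 → Bool) → Bool} (hg : IsMinority g) {k : ℕ}
    {R : Relation Bool k} (hR : IsPolymorphism g R) :
    ∀ (T : List (Fin k → Bool)), (∀ t ∈ T, t ∈ R) → ∀ z : List Bool,
      (dot (T.map fun _ => true) z = true → (fun p => dot (T.map fun t => t p) z) ∈ R) ∧
      (dot (T.map fun _ => true) z = false → ∀ r ∈ R,
        (fun p => r p ^^ dot (T.map fun t => t p) z) ∈ R) := by
  intro T
  induction T with
  | nil => intro _ z; simp [dot_nil]
  | cons t T ih =>
    intro hT z
    have ih' := ih fun x hx => hT x (List.mem_cons_of_mem _ hx)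
    have ht := hT t List.mem_cons_self
    cases z with
    | nil => simp [dot]
    | cons b z =>
      obtain ⟨h1, h2⟩ := ih' z
      cases b
      · simpa [dot] using And.intro h1 h2
      -- With `t` present, an odd combination is `t` plus an even combination of the rest. For an
      -- even one, the rest is odd and hence lies in `R`, and adding `r` and `t` is one application
      -- of the minority operation.
      · constructor
        · intro h
          simpa [dot] using h2 (by simpa [dot] using h) t ht
        · intro h r hr
          have h3 := h1 (by simpa [dot] using h)
          have h4 := hR ![r, t, fun p => dot (T.map fun t => t p) z] fun j => by
            fin_cases j
            · exact hr
            · exact ht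
            · exact h3
          convert h4 using 2 with p
          rw [show (fun j => (![r, t, fun p => dot (T.map fun t => t p) z] : Fin 3 → Fin k → Bool)
              j p) = ![r p, t p, dot (T.map fun t => t p) z] by
            funext j; fin_cases j <;> rfl, minority_eq_xor hg]
          simp [dot]

/-- The index of a variable in unary. -/
def ticks {n : ℕ} (i : Fin n) : List Bool := List.replicate i.val false

/-- The data of a constraint. -/
def conData {Γ : ConstraintLanguage Bool} {n : ℕ} (C : Constraint Γ (Fin n)) : ConData :=
  ((List.ofFn C.scope).map ticks, C.tuples.map List.ofFn)

theorem dot_ticks {n : ℕ} (i : Fin n) (x : Fin n → Bool) :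
    dot (ticks i ++ [true]) (List.ofFn x) = x i := by
  rw [ticks, dot_unit]
  simp

theorem sat_cons (r : Row) (rows : List Row) (y : List Bool) :
    Sat (r :: rows) y ↔ rowVal r y = false ∧ Sat rows y := List.forall_mem_cons

theorem sat_append (rows rows' : List Row) (y : List Bool) :
    Sat (rows ++ rows') y ↔ Sat rows y ∧ Sat rows' y := by
  simp only [Sat, List.forall_mem_append]

/-- The columns of the tuple coefficients come first and those of the variables of the instance
after them, so eliminating leading columns later removes exactly the coefficients. -/
theorem sat_positionRows {n : ℕ} (x : Fin n → Bool) {k : ℕ} (scope : Fin k → Fin n)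
    (T : List (Fin k → Bool)) (z : List Bool) (hz : z.length = T.length) :
    Sat (positionRows ((List.ofFn scope).map ticks) (T.map List.ofFn)) (z ++ List.ofFn x) ↔
      ∀ p, x (scope p) = dot (T.map fun t => t p) z := by
  induction k with
  | zero => simp [positionRows, Sat]
  | succ k ih =>
    have e : (T.map List.ofFn).map List.tail = (T.map fun t p => t (Fin.succ p)).map List.ofFn := by
      simp [List.ofFn_succ, Function.comp_def]
    have e' : (T.map List.ofFn).map (fun t => t.headD false) = T.map fun t => t 0 := by
      simp [List.ofFn_succ, Function.comp_def]
    rw [List.ofFn_succ, List.map_cons, positionRows, sat_cons, e,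
      ih (fun p => scope p.succ) (T.map fun t p => t (Fin.succ p)) (by simpa using hz),
      Fin.forall_fin_succ, rowVal, e', dot_append _ _ (by simp [hz]), dot_ticks]
    refine and_congr ?_ (forall_congr' fun p => ?_)
    · cases dot (T.map fun t => t 0) z <;> cases x (scope 0) <;> simp
    · simp [Function.comp_def]

/-- Eliminating the coefficients leaves the statement that the assignment, restricted to the scope,
is an odd combination of tuples. By `combination_mem` such a combination is a tuple of the relation;
conversely a tuple is the combination with itself as the only term. -/
theorem sat_constraintRows {Γ : ConstraintLanguage Bool} {g : (Fin 3 → Bool) → Bool}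
    (hg : IsMinority g) (hΓ : ∀ R ∈ Γ, IsPolymorphism g R.2) {n : ℕ} (C : Constraint Γ (Fin n))
    (x : Fin n → Bool) : Sat (constraintRows (conData C)) (List.ofFn x) ↔
      (fun i => x (C.scope i)) ∈ C.relation := by
  have hR : IsPolymorphism g C.relation := hΓ _ C.mem_language
  have e : (C.tuples.map List.ofFn).map (fun _ => true) = C.tuples.map fun _ => true := by
    simp [Function.comp_def]
  rw [constraintRows, sat_elimMany]
  have key : ∀ z : List Bool, z.length = C.tuples.length →
      (Sat ((true, (conData C).2.map fun _ => true) ::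
        positionRows (conData C).1 (conData C).2) (z ++ List.ofFn x) ↔
      dot (C.tuples.map fun _ => true) z = true ∧
        ∀ p, x (C.scope p) = dot (C.tuples.map fun t => t p) z) := by
    intro z hz
    rw [sat_cons, conData, sat_positionRows x C.scope C.tuples z hz, rowVal]
    dsimp only
    -- The parity equation has no coefficients in the columns of the variables; the appended empty
    -- list makes this visible to `dot_append`.
    rw [e, ← List.append_nil (C.tuples.map fun _ => true), dot_append _ _ (by simp [hz]), dot_nil]
    simp
  constructor
  · rintro ⟨z, hz, h⟩
    rw [key z (by simpa [conData] using hz)] at h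
    have := (combination_mem hg hR C.tuples (fun t ht => ht) z).1 h.1
    rwa [← funext h.2] at this
  · intro h
    obtain ⟨z, hz, h'⟩ := exists_unitVector (T := C.tuples) h
    refine ⟨z, by simpa [conData] using hz, (key z hz).2 ⟨h' fun _ => true, fun p => ?_⟩⟩
    exact (h' fun t => t p).symm

theorem sat_system {Γ : ConstraintLanguage Bool} {g : (Fin 3 → Bool) → Bool}
    (hg : IsMinority g) (hΓ : ∀ R ∈ Γ, IsPolymorphism g R.2) (I : CSPInstance Γ)
    (x : Fin I.numVars → Bool) :
    Sat ((I.constraints.map conData).flatMap constraintRows) (List.ofFn x) ↔ x ∈ I.Sol := by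
  have : Sat ((I.constraints.map conData).flatMap constraintRows) (List.ofFn x) ↔
      ∀ C ∈ I.constraints, Sat (constraintRows (conData C)) (List.ofFn x) := by
    simp only [Sat, List.mem_flatMap, List.mem_map]
    constructor
    · intro h C hC r hr
      exact h r ⟨_, ⟨C, hC, rfl⟩, hr⟩
    · rintro h r ⟨_, ⟨C, hC, rfl⟩, hr⟩
      exact h C hC r hr
  rw [this]
  exact forall₂_congr fun C _ => sat_constraintRows hg hΓ C x

section
variable {Γ : ConstraintLanguage Bool} {d : ℕ}

/-! ### The polynomial as a function on the solutions -/

/-- The data of a term. -/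
def termData {n : ℕ} (t : ℚ × List (Fin n)) : TermData :=
  ((decide (t.1.num < 0), t.1.num.natAbs.bits), (t.1.den.bits, t.2.map ticks))

/-- The value of a monomial at a Boolean point. -/
def monVal {n : ℕ} (l : List (Fin n)) (x : Fin n → Bool) : ℚ := if l.all x then 1 else 0

theorem prod_boolVal (F : Type*) [Field F] {n : ℕ} (l : List (Fin n)) (x : Fin n → Bool) :
    (l.map fun i => boolVal F (x i)).prod = if l.all x then 1 else 0 := by
  induction l with
  | nil => simp
  | cons i l ih => cases h : x i <;> simp_all [boolVal]

/-- The value of the input polynomial at a Boolean point. -/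
def polyVal (I : IMPInstance Γ d) (x : Fin I.csp.numVars → Bool) : ℚ :=
  (I.terms.map fun t => t.1 * monVal t.2 x).sum

theorem aeval_poly (F : Type*) [Field F] [CharZero F] (I : IMPInstance Γ d)
    (x : Fin I.csp.numVars → Bool) :
    MvPolynomial.aeval (fun i => boolVal F (x i)) (MvPolynomial.map (algebraMap ℚ F) I.poly) =
      algebraMap ℚ F (polyVal I x) := by
  have hprod := prod_boolVal F (n := I.csp.numVars)
  rw [IMPInstance.poly, polyVal, map_list_sum, map_list_sum, map_list_sum, List.map_map,
    List.map_map, List.map_map]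
  congr 1
  refine List.map_congr_left fun t _ => ?_
  simp only [Function.comp_apply, map_mul, MvPolynomial.map_C, map_list_prod, List.map_map,
    MvPolynomial.aeval_C, Algebra.algebraMap_self, RingHom.id_apply]
  congr 1
  have h := hprod t.2 x
  rw [monVal, apply_ite (algebraMap ℚ F), map_one, map_zero, ← h]
  congr 1
  refine List.map_congr_left fun i _ => ?_
  simp

/-- The values at Boolean points are images of rational numbers, and ℚ → `F` is injective, so the
answer does not depend on `F`. -/
theorem member_iff (F : Type*) [Field F] [CharZero F] (I : IMPInstance Γ d) :
    I.Member F ↔ ∀ x ∈ I.csp.Sol, polyVal I x = 0 := by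
  unfold IMPInstance.Member combinatorialIdeal
  rw [MvPolynomial.mem_vanishingIdeal_iff, Set.forall_mem_image]
  refine forall₂_congr fun x _ => ?_
  rw [aeval_poly, map_eq_zero]

open Classical in
/-- A polynomial vanishes on a set of points iff it is orthogonal to all its monomials. -/
theorem vanishes_iff_orthogonal (I : IMPInstance Γ d) :
    (∀ x ∈ I.csp.Sol, polyVal I x = 0) ↔ ∀ s ∈ I.terms,
      ∑ x, (if x ∈ I.csp.Sol then polyVal I x * monVal s.2 x else 0) = 0 := by
  constructor
  · intro h s _
    refine Finset.sum_eq_zero fun x _ => ?_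
    split_ifs with hx
    · rw [h x hx, zero_mul]
    · rfl
  · intro h
    have hsq : ∑ x, (if x ∈ I.csp.Sol then polyVal I x * polyVal I x else 0) = 0 := by
      -- The second factor is expanded into its terms, so that the sum becomes a linear combination
      -- of the inner products assumed to vanish.
      have key : ∀ ts : List (ℚ × List (Fin I.csp.numVars)), (∀ s ∈ ts, s ∈ I.terms) →
          ∑ x, (if x ∈ I.csp.Sol then
            polyVal I x * (ts.map fun t => t.1 * monVal t.2 x).sum else 0) = 0 := by
        intro ts
        induction ts with
        | nil => simp
        | cons s ts ih =>
          intro hts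
          have h1 := h s (hts s List.mem_cons_self)
          have h2 := ih fun t ht => hts t (List.mem_cons_of_mem _ ht)
          calc _ = s.1 * ∑ x, (if x ∈ I.csp.Sol then polyVal I x * monVal s.2 x else 0) +
                ∑ x, (if x ∈ I.csp.Sol then
                  polyVal I x * (ts.map fun t => t.1 * monVal t.2 x).sum else 0) := by
                rw [Finset.mul_sum, ← Finset.sum_add_distrib]
                refine Finset.sum_congr rfl fun x _ => ?_
                split_ifs
                · rw [List.map_cons, List.sum_cons]; ring
                · simp
            _ = 0 := by rw [h1, h2]; simp
      exact key I.terms fun _ h => h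
    intro x hx
    -- This is where the order of ℚ enters: all summands are squares or zero.
    have := (Finset.sum_eq_zero_iff_of_nonneg fun x _ => by
      split_ifs
      · exact mul_self_nonneg _
      · exact le_rfl).1 hsq x (Finset.mem_univ x)
    rw [if_pos hx] at this
    exact mul_self_eq_zero.1 this

/-! ### Correctness of the summation -/

/-- The value of a fraction. -/
def fracVal (a : List Bool × List Bool × List Bool) : ℚ :=
  ((val a.1 : ℚ) - val a.2.1) / val a.2.2

/-- A negative coefficient is added to the negative part and any other to the positive part, so
natural numbers suffice. The denominator stays nonzero, which is needed for the next addition and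
for the final test. -/
theorem val_addFraction {n : ℕ} (t : ℚ × List (Fin n)) (k : List Bool)
    (a : List Bool × List Bool × List Bool) (ha : val a.2.2 ≠ 0) :
    fracVal (addFraction (termData t) k a) = fracVal a + t.1 * val k ∧
      val (addFraction (termData t) k a).2.2 ≠ 0 := by
  have hd : (t.1.den : ℚ) ≠ 0 := by exact_mod_cast t.1.den_nz
  have ha' : (val a.2.2 : ℚ) ≠ 0 := by exact_mod_cast ha
  have hq : t.1 = (t.1.num : ℚ) / t.1.den := (Rat.num_div_den _).symm
  constructor
  · unfold fracVal addFraction termData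
    dsimp only
    by_cases hn : t.1.num < 0
    · have hnum : ((t.1.num.natAbs : ℕ) : ℚ) = -(t.1.num : ℚ) := by
        rw [Nat.cast_natAbs, abs_of_neg hn, Int.cast_neg]
      simp only [hn, decide_true, cond_true, val_addBits, val_mulBits, val_bits, Nat.cast_add,
        Nat.cast_mul, hnum, val, Nat.cast_zero]
      conv_rhs => rw [hq]
      field_simp
      ring
    · have hnum : ((t.1.num.natAbs : ℕ) : ℚ) = (t.1.num : ℚ) := by
        rw [Nat.cast_natAbs, abs_of_nonneg (not_lt.1 hn)]
      simp only [hn, decide_false, cond_false, val_addBits, val_mulBits, val_bits, Nat.cast_add,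
        Nat.cast_mul, hnum, val, Nat.cast_zero]
      conv_rhs => rw [hq]
      field_simp
      ring
  · simp only [addFraction, termData, val_mulBits, val_bits]
    exact mul_ne_zero t.1.den_nz ha

theorem sat_varRows {n : ℕ} (l : List (Fin n)) (x : Fin n → Bool) :
    Sat ((l.map ticks).map varRow) (List.ofFn x) ↔ l.all x = true := by
  simp only [Sat, List.map_map, List.forall_mem_map, List.all_eq_true]
  refine forall₂_congr fun i _ => ?_
  rw [Function.comp_apply, varRow, rowVal, dot_ticks]
  cases x i <;> simp

open Classical in
-- On Boolean points a product of monomials is the indicator of all their variables being one. This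
-- condition is affine, so the sum counts the solutions of a larger linear system.
theorem val_commonCount {g : (Fin 3 → Bool) → Bool} (hg : IsMinority g)
    (hΓ : ∀ R ∈ Γ, IsPolymorphism g R.2) (I : IMPInstance Γ d)
    (s t : ℚ × List (Fin I.csp.numVars)) :
    (val (commonCount (List.replicate I.csp.numVars false)
      ((I.csp.constraints.map conData).flatMap constraintRows) (termData s) (termData t)) : ℚ) =
      ∑ x, (if x ∈ I.csp.Sol then monVal t.2 x * monVal s.2 x else 0) := by
  rw [commonCount, val_countSol, List.length_replicate, numSol, Nat.cast_sum]
  refine Finset.sum_congr rfl fun x _ => ?_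
  have h : Sat ((I.csp.constraints.map conData).flatMap constraintRows ++
      ((termData s).2.2 ++ (termData t).2.2).map varRow) (List.ofFn x) ↔
      x ∈ I.csp.Sol ∧ s.2.all x = true ∧ t.2.all x = true := by
    simp only [termData]
    rw [List.map_append, sat_append, sat_append, sat_system hg hΓ, sat_varRows, sat_varRows]
  rw [if_congr h rfl rfl]
  unfold monVal
  by_cases h1 : x ∈ I.csp.Sol <;> cases h2 : s.2.all x <;> cases h3 : t.2.all x <;> simp [h1]

open Classical in
theorem fracVal_inner {g : (Fin 3 → Bool) → Bool} (hg : IsMinority g)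
    (hΓ : ∀ R ∈ Γ, IsPolymorphism g R.2) (I : IMPInstance Γ d)
    (s : ℚ × List (Fin I.csp.numVars)) :
    let a := inner (List.replicate I.csp.numVars false)
      ((I.csp.constraints.map conData).flatMap constraintRows) (I.terms.map termData) (termData s)
    fracVal a = ∑ x, (if x ∈ I.csp.Sol then polyVal I x * monVal s.2 x else 0) ∧
      val a.2.2 ≠ 0 := by
  have key : ∀ (ts : List (ℚ × List (Fin I.csp.numVars))) (a : List Bool × List Bool × List Bool),
      val a.2.2 ≠ 0 →
      let a' := (ts.map termData).foldl (fun a t => addFraction t (commonCount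
        (List.replicate I.csp.numVars false)
        ((I.csp.constraints.map conData).flatMap constraintRows) (termData s) t) a) a
      fracVal a' = fracVal a + ∑ x, (if x ∈ I.csp.Sol then
        (ts.map fun t => t.1 * monVal t.2 x).sum * monVal s.2 x else 0) ∧ val a'.2.2 ≠ 0 := by
    intro ts
    induction ts with
    | nil => intro a ha; simpa using ha
    | cons t ts ih =>
      intro a ha
      obtain ⟨h1, h2⟩ := val_addFraction t (commonCount (List.replicate I.csp.numVars false)
        ((I.csp.constraints.map conData).flatMap constraintRows) (termData s) (termData t)) a ha
      obtain ⟨h3, h4⟩ := ih _ h2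
      refine ⟨?_, h4⟩
      rw [List.map_cons, List.foldl_cons, h3, h1, val_commonCount hg hΓ, add_assoc,
        Finset.mul_sum, ← Finset.sum_add_distrib]
      congr 1
      refine Finset.sum_congr rfl fun x _ => ?_
      split_ifs
      · rw [List.map_cons, List.sum_cons]; ring
      · simp
  obtain ⟨h1, h2⟩ := key I.terms ([], [], [true]) (by simp [val])
  refine ⟨h1.trans ?_, h2⟩
  simp [fracVal, val, polyVal]

theorem decideParsed_iff {g : (Fin 3 → Bool) → Bool} (hg : IsMinority g)
    (hΓ : ∀ R ∈ Γ, IsPolymorphism g R.2) (I : IMPInstance Γ d) :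
    decideParsed (List.replicate I.csp.numVars false) (I.csp.constraints.map conData)
      (I.terms.map termData) = true ↔ ∀ x ∈ I.csp.Sol, polyVal I x = 0 := by
  classical
  rw [vanishes_iff_orthogonal, decideParsed, List.all_map, List.all_eq_true]
  refine forall₂_congr fun s _ => ?_
  obtain ⟨h1, h2⟩ := fracVal_inner hg hΓ I s
  -- As the denominator is nonzero, the fraction is zero iff its positive and negative parts are
  -- equal.
  rw [← h1, fracVal, Function.comp_apply, ← val_eq_iff, div_eq_zero_iff, sub_eq_zero,
    Nat.cast_inj, Nat.cast_eq_zero, or_iff_left h2]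

/-! ### Correctness of the parser -/

theorem foldr_ticks (n : ℕ) (t b : List Bool) (v u : List (List Bool)) (e : List Bool)
    (c : List ConData) (p : List TermData) :
    (List.replicate n Letter.tick).foldr parseStep (t, b, v, u, e, c, p) =
      (List.replicate n false ++ t, b, v, u, e, c, p) := by
  induction n with
  | zero => rfl
  | succ n ih => simp [List.replicate_succ, ih, parseStep]

theorem foldr_bits (l : List Bool) (t b : List Bool) (v u : List (List Bool)) (e : List Bool)
    (c : List ConData) (p : List TermData) :
    (l.map Letter.bit).foldr parseStep (t, b, v, u, e, c, p) = (t, l ++ b, v, u, e, c, p) := by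
  induction l with
  | nil => rfl
  | cons x l ih => rw [List.map_cons, List.foldr_cons, ih]; rfl

theorem foldr_vars {n : ℕ} (l : List (Fin n)) (b : List Bool) (v u : List (List Bool))
    (e : List Bool) (c : List ConData) (p : List TermData) :
    (l.flatMap encodeVar).foldr parseStep ([], b, v, u, e, c, p) =
      ([], b, l.map ticks ++ v, u, e, c, p) := by
  induction l with
  | nil => rfl
  | cons i l ih =>
    rw [List.flatMap_cons, List.foldr_append, ih, encodeVar, List.foldr_cons, foldr_ticks]
    simp [parseStep, ticks]

theorem foldr_tuples {k : ℕ} (l : List (Fin k → Bool)) (t : List Bool) (v u : List (List Bool))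
    (e : List Bool) (c : List ConData) (p : List TermData) :
    (l.flatMap fun t => Letter.tup :: (List.ofFn t).map Letter.bit).foldr parseStep
      (t, [], v, u, e, c, p) = (t, [], v, l.map List.ofFn ++ u, e, c, p) := by
  induction l with
  | nil => rfl
  | cons x l ih =>
    rw [List.flatMap_cons, List.foldr_append, ih, List.foldr_cons, foldr_bits]
    simp [parseStep]

theorem foldr_constraints {n : ℕ} (l : List (Constraint Γ (Fin n))) (e : List Bool)
    (c : List ConData) (p : List TermData) :
    (l.flatMap encodeConstraint).foldr parseStep ([], [], [], [], e, c, p) =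
      ([], [], [], [], e, l.map conData ++ c, p) := by
  induction l with
  | nil => rfl
  | cons C l ih =>
    rw [List.flatMap_cons, List.foldr_append, ih, encodeConstraint, List.foldr_cons,
      List.foldr_append, foldr_tuples, foldr_vars]
    simp [parseStep, conData]

theorem foldr_terms {n : ℕ} (l : List (ℚ × List (Fin n))) :
    (l.flatMap encodeTerm).foldr parseStep parseInit =
      ([], [], [], [], [], [], l.map termData) := by
  induction l with
  | nil => rfl
  | cons t l ih =>
    rw [List.flatMap_cons, List.foldr_append, ih, encodeTerm, List.foldr_cons,
      List.foldr_append, foldr_vars, encodeRat, List.foldr_cons, List.foldr_append,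
      List.foldr_cons, foldr_bits]
    simp only [parseStep, foldr_bits]
    simp [termData]

/-- The ticks at the front are preceded by no marker, so they stay pending and give the number of
variables in unary. The separators can be ignored, since every item starts with its own marker. -/
theorem parse_encodeIMP (I : IMPInstance Γ d) : parse (encodeIMP I) =
    (List.replicate I.csp.numVars false, [], [], [], [], I.csp.constraints.map conData,
      I.terms.map termData) := by
  have hsep : ∀ s, parseStep .sep s = s := fun _ => rfl
  rw [parse, encodeIMP, List.foldr_append, List.foldr_cons, List.foldr_append, List.foldr_cons,
    foldr_terms, hsep, hsep, foldr_constraints, foldr_ticks]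
  simp

theorem decideReversed_iff (F : Type*) [Field F] [CharZero F] {g : (Fin 3 → Bool) → Bool}
    (hg : IsMinority g) (hΓ : ∀ R ∈ Γ, IsPolymorphism g R.2) (I : IMPInstance Γ d) :
    decideReversed (encodeIMP I).reverse = true ↔ I.Member F := by
  rw [decideReversed, List.reverse_reverse, parse_encodeIMP, member_iff]
  exact decideParsed_iff hg hΓ I

end
end PolyTime

theorem corollary1 (F : Type*) [Field F] [CharZero F]
    (Γ : BooleanIMP.ConstraintLanguage Bool)
    (minority : (Fin 3 → Bool) → Bool) (hminority : BooleanIMP.IsMinority minority)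
    (hΓ : ∀ R ∈ Γ, BooleanIMP.IsPolymorphism minority R.2)
    (d : ℕ) :
    BooleanIMP.SolvableInPolyTime
      (fun I : BooleanIMP.IMPInstance Γ d => BooleanIMP.encodeIMP I)
      (fun I => I.Member F) :=
  PolyTime.ptime_decideReversed.solvable
    fun I => PolyTime.decideReversed_iff F hminority hΓ I
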